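/- Fix integers $n\ge 1$ and $N\ge 2$, let $n/2<s_k\le n$ and $n/s_k<p_k<\infty$ for $k=1,\dots,N$, put $q_k=n/s_k$, and define $p$ by $1/p=1/p_1+\dots+1/p_N$. For $N$-tuples $\vec w=(w_1,\dots,w_N)$ of weights on $\mathbb R^n$ (measurable, nonnegative, a.e. positive functions) put $\nu_{\vec w}=\prod_{k=1}^N w_k^{p/p_k}$, and say that $\vec w\in A_{\vec P/\vec Q}$ if $$\sup_Q\Big(\frac1{|Q|}\int_Q\nu_{\vec w}\,dx\Big)^{1/p}\prod_{k=1}^N\Big(\frac1{|Q|}\int_Q w_k^{1-(p_k/q_k)'}\,dx\Big)^{1/q_k-1/p_k}<\infty,$$ the supremum being over all cubes $Q\subset\mathbb R^n$ with sides parallel to the axes, where $r'=r/(r-1)$. With $\widehat f(\xi)=\int e^{-ix\cdot\xi}f(x)\,dx$, let, for $m\in L^\infty(\mathbb R^{Nn})$ and Schwartz functions $f_1,\dots,f_N$ on $\mathbb R^n$, $$T_m(f_1,\dots,f_N)(x)=\frac1{(2\pi)^{Nn}}\int_{\mathbb R^{Nn}}e^{ix\cdot(\xi_1+\dots+\xi_N)}m(\xi)\widehat{f_1}(\xi_1)\cdots\widehat{f_N}(\xi_N)\,d\xi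 .$$ Let $\|T_m\|_{L^{p_1}(w_1)\times\dots\times L^{p_N}(w_N)\to L^p(\nu_{\vec w})}$ be the smallest $C\in[0,\infty]$ such that $\|T_m(f_1,\dots,f_N)\|_{L^p(\nu_{\vec w})}\le C\prod_k\|f_k\|_{L^{p_k}(w_k)}$ for all Schwartz functions $f_k$ with $\|f_k\|_{L^{p_k}(w_k)}<\infty$, where $\|f\|_{L^p(w)}=(\int|f|^pw\,dx)^{1/p}$. Let $$\|F\|_{W^{(s_1,\dots,s_N)}(\mathbb R^{Nn})}=\Big(\int_{\mathbb R^{Nn}}(1+|\xi_1|^2)^{s_1}\cdots(1+|\xi_N|^2)^{s_N}|\widehat F(\xi)|^2\,d\xi\Big)^{1/2}.$$ For a Schwartz function $\Psi$ on $\mathbb R^{Nn}$ with $\operatorname{supp}\Psi\subset\{1/2\le|\xi|\le2\}$ and $\sum_{k\in\mathbb Z}\Psi(\xi/2^k)=1$ for $\xi\ne0$, put $m_j(\xi)=m(2^j\xi)\Psi(\xi)$, $j\in\mathbb Z$. Then there are real numbers $\alpha_1,\alpha_2$ with $$\frac{\alpha_1}{p_1}+\frac{\alpha_2}{p_2}>-\frac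 np,\qquad \frac{\alpha_k}{p_k}<s_k-\frac n{p_k}\ (k=1,2),\qquad \frac{\alpha_1}{p_1}<-\frac n{p_1}-s_1+\frac n2,$$ such that $\vec w=(|x|^{\alpha_1},|x|^{\alpha_2},1,\dots,1)$ belongs to $A_{\vec P/\vec Q}$ and, for every such $\Psi$, the estimate $$\|T_m\|_{L^{p_1}(w_1)\times\dots\times L^{p_N}(w_N)\to L^p(\nu_{\vec w})}\le C\sup_{j\in\mathbb Z}\|m_j\|_{W^{(s_1,\dots,s_N)}(\mathbb R^{Nn})}\qquad\text{for all }m\in L^\infty(\mathbb R^{Nn})$$ fails for every constant $C\in(0,\infty)$. -/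

import Mathlib

open MeasureTheory
open scoped ENNReal NNReal SchwartzMap

noncomputable section

namespace MultilinearMultiplier

/-- `ℝⁿ` with the Euclidean norm. -/
abbrev E (n : ℕ) : Type := EuclideanSpace ℝ (Fin n)

/-- `ℝ^{Nn} = ℝⁿ × ⋯ × ℝⁿ` (`N` factors) with the Euclidean norm
`|ξ| = (|ξ₁|² + ⋯ + |ξ_N|²)^{1/2}`; the `k`-th block of `ξ` is `ξ k`. -/
abbrev EN (N n : ℕ) : Type := PiLp 2 (fun _ : Fin N => E n)

/-- The Fourier transform `∫ e^{-i x·ξ} f(x) dx` of an integrable function, normalized without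
`2π` in the exponent. -/
def fourierTransform {V : Type*} [NormedAddCommGroup V] [InnerProductSpace ℝ V]
    [FiniteDimensional ℝ V] [MeasurableSpace V] [BorelSpace V] (f : V → ℂ) (ξ : V) : ℂ :=
  ∫ x : V, Complex.exp (-(Complex.I * ((inner ℝ x ξ : ℝ) : ℂ))) * f x

/-- The `N`-linear Fourier multiplier operator
`T_m(f)(x) = (2π)^{-Nn} ∫ e^{i x·(ξ₁ + ⋯ + ξ_N)} m(ξ) f̂₁(ξ₁) ⋯ f̂_N(ξ_N) dξ`. -/
def multiplierOp {N n : ℕ} (m : EN N n → ℂ) (f : Fin N → 𝓢(E n, ℂ)) (x : E n) : ℂ :=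
  (1 / (2 * (Real.pi : ℂ)) ^ (N * n)) *
    ∫ ξ : EN N n, Complex.exp (Complex.I * ((inner ℝ x (∑ k, ξ k) : ℝ) : ℂ)) * m ξ *
      ∏ k, fourierTransform (f k) (ξ k)

/-- `‖F‖_{W^{(s₁,…,s_N)}}`, the norm of the Sobolev space of product type, for integrable `F`. -/
def sobolevNorm {N n : ℕ} (s : Fin N → ℝ) (F : EN N n → ℂ) : ℝ≥0∞ :=
  (∫⁻ ξ : EN N n, ENNReal.ofReal
    ((∏ k, (1 + ‖ξ k‖ ^ 2) ^ s k) * ‖fourierTransform F ξ‖ ^ 2)) ^ (1 / 2 : ℝ)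

/-- The Schwartz functions `Ψ` supported in the annulus `1/2 ≤ |ξ| ≤ 2` whose dyadic dilates form a
partition of unity away from the origin. -/
structure IsDyadicPartition {N n : ℕ} (Ψ : 𝓢(EN N n, ℂ)) : Prop where
  support_subset : tsupport (Ψ : EN N n → ℂ) ⊆ {ξ | 1 / 2 ≤ ‖ξ‖ ∧ ‖ξ‖ ≤ 2}
  hasSum_one : ∀ ξ : EN N n, ξ ≠ 0 → HasSum (fun k : ℤ => Ψ (((2 : ℝ) ^ k)⁻¹ • ξ)) 1

/-- The localized pieces `m_j(ξ) = m(2^j ξ) Ψ(ξ)`. -/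
def dyadicPiece {N n : ℕ} (Ψ : 𝓢(EN N n, ℂ)) (m : EN N n → ℂ) (j : ℤ) (ξ : EN N n) : ℂ :=
  m (((2 : ℝ) ^ j) • ξ) * Ψ ξ

/-- `‖f‖_{L^p(w)} = (∫ |f|^p w dx)^{1/p}` for `0 < p < ∞`, with values in `[0, ∞]`. -/
def weightedNorm {n : ℕ} (p : ℝ) (w : E n → ℝ) (f : E n → ℂ) : ℝ≥0∞ :=
  (∫⁻ x : E n, ‖f x‖ₑ ^ p * ENNReal.ofReal (w x)) ^ (1 / p)

/-- `ν_w = ∏ w_k^{p/p_k}`. -/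
def productWeight {N n : ℕ} (p : ℝ) (P : Fin N → ℝ) (w : Fin N → E n → ℝ) (x : E n) : ℝ :=
  ∏ k, (w k x) ^ (p / P k)

/-- `‖T‖_{L^{p₁}(w₁) × ⋯ × L^{p_N}(w_N) → L^p(ν)}`: the smallest `C ∈ [0, ∞]` with
`‖T f‖_{L^p(ν)} ≤ C ∏ ‖f_k‖_{L^{p_k}(w_k)}` for all Schwartz functions `f₁, …, f_N`. Tuples with
some `‖f_k‖_{L^{p_k}(w_k)} = ∞` impose no condition. -/
def opNorm {N n : ℕ} (p : ℝ) (P : Fin N → ℝ) (w : Fin N → E n → ℝ) (ν : E n → ℝ)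
    (T : (Fin N → 𝓢(E n, ℂ)) → E n → ℂ) : ℝ≥0∞ :=
  sInf {C : ℝ≥0∞ | ∀ f : Fin N → 𝓢(E n, ℂ), (∀ k, weightedNorm (P k) (w k) (f k) < ∞) →
    weightedNorm p ν (T f) ≤ C * ∏ k, weightedNorm (P k) (w k) (f k)}

/-- The cube with lower corner `a` and side length `r`, with sides parallel to the axes. -/
def cube {n : ℕ} (a : E n) (r : ℝ) : Set (E n) := {x | ∀ i, a i ≤ x i ∧ x i ≤ a i + r}

/-- A weight: a nonnegative measurable function that is positive almost everywhere. -/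
structure IsWeight {n : ℕ} (w : E n → ℝ) : Prop where
  measurable : Measurable w
  nonneg : ∀ x, 0 ≤ w x
  ae_pos : ∀ᵐ x, 0 < w x

/-- The class `A_{P/Q}`, for `1 ≤ q_k < p_k` and `1/p = 1/p₁ + ⋯ + 1/p_N`: the tuples of weights
such that
`(1/|Q| ∫_Q ν_w)^{1/p} ∏ (1/|Q| ∫_Q w_k^{1-(p_k/q_k)'})^{1/q_k - 1/p_k}`
is bounded uniformly in the cubes `Q`. -/
structure MemWeightClass {N n : ℕ} (p : ℝ) (P Q : Fin N → ℝ) (w : Fin N → E n → ℝ) : Prop where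
  isWeight : ∀ k, IsWeight (w k)
  sup_lt_top : (⨆ (a : E n) (r : ℝ) (_ : 0 < r),
    (⨍⁻ x in cube a r, ENNReal.ofReal (productWeight p P w x) ∂volume) ^ (1 / p) *
      ∏ k, (⨍⁻ x in cube a r,
        ENNReal.ofReal (w k x) ^ (1 - Real.conjExponent (P k / Q k)) ∂volume) ^ (1 / Q k - 1 / P k)) < ∞

/-- The tuple `(|x|^{α₁}, |x|^{α₂}, 1, …, 1)`. -/
def powerWeights (N n : ℕ) (α₁ α₂ : ℝ) (k : Fin N) (x : E n) : ℝ :=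
  if k.val = 0 then ‖x‖ ^ α₁ else if k.val = 1 then ‖x‖ ^ α₂ else 1

/-- The estimate `‖T_m‖_{L^{p₁}(w₁) × ⋯ × L^{p_N}(w_N) → L^p(ν_w)} ≲ sup_j ‖m_j‖_{W^{(s₁,…,s_N)}}`
for `m ∈ L^∞(ℝ^{Nn})`, with a constant independent of `m`. -/
def MultiplierEstimate {N n : ℕ} (p : ℝ) (P s : Fin N → ℝ) (w : Fin N → E n → ℝ)
    (Ψ : 𝓢(EN N n, ℂ)) : Prop :=
  ∃ C : ℝ≥0, 0 < C ∧ ∀ m : EN N n → ℂ, MemLp m ∞ volume →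
    opNorm p P w (productWeight p P w) (multiplierOp m) ≤
      C * ⨆ j : ℤ, sobolevNorm s (dyadicPiece Ψ m j)

end MultilinearMultiplier

end

noncomputable section

namespace MultilinearMultiplier

/-! The estimate fails on tensor products in which only the first variable is rescaled. Take `m(ξ) =
∏ χ(R_k ξ_k)` and `f_k(x) = φ(x / R_k)`, with `R_k = R` for the first factor, `R_k = 1` for the
others, and `R → ∞`.

On the left, `T_m(f)(x)` is a nonzero constant times `∏ profile χ φ (x / R_k)`
(`exists_multiplierOp_prod_dilate`). If `profile χ φ 0 ≠ 0`, this is bounded below near the origin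
uniformly in `R ≥ 1`, and so is its weighted norm. On the right, `‖f_1‖` scales like `R^((n +
α₁)/p₁)`. Because some `R_k` equals `1`, the support of `m` meets only boundedly many dyadic annuli,
and the supremum of the Sobolev norms is at most a constant times `R^(s₁ - n/2)`
(`exists_iSup_sobolevNorm_dyadicPiece_le`). The estimate would therefore bound a fixed positive
number by a constant times `R^(s₁ - n/2 + (n + α₁)/p₁)`. The last condition on `α₁` says exactly
that this exponent is negative (`not_multiplierEstimate_norm_rpow`).

Such an `α₁` lies below `-n`, so the first weight is not locally integrable. The tuple can still
belong to the class, since there only the product weight has to be locally integrable, and a large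
`α₂` compensates (`memWeightClass_norm_rpow`). The bounds `s₁ ≤ n` and `s₂ > n/2` leave room for
both choices. -/

/-! ### Fourier transforms of tensor products, dilates and products -/

open FourierTransform in
theorem fourierTransform_eq_fourier {V : Type*} [NormedAddCommGroup V] [InnerProductSpace ℝ V]
    [FiniteDimensional ℝ V] [MeasurableSpace V] [BorelSpace V] (f : V → ℂ) (ξ : V) :
    fourierTransform f ξ = 𝓕 f ((2 * Real.pi)⁻¹ • ξ) := by
  rw [Real.fourier_eq, fourierTransform]
  congr 1 with x
  rw [Circle.smul_def, Real.fourierChar_apply, inner_smul_right, smul_eq_mul]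
  congr 2
  have : (Real.pi : ℂ) ≠ 0 := by exact_mod_cast Real.pi_ne_zero
  push_cast
  field_simp

/-- The Lebesgue measure of `ℝ^{Nn}` is proportional to the product of the Lebesgue measures of
the blocks. -/
theorem exists_volume_eq_smul_map_toLp (N n : ℕ) : ∃ c : ℝ≥0, c ≠ 0 ∧
    (volume : Measure (EN N n)) =
      c • Measure.map (WithLp.toLp 2) (volume : Measure (Fin N → E n)) := by
  have hm : (Measure.map (WithLp.toLp 2) (volume : Measure (Fin N → E n)) :
      Measure (EN N n)).IsAddHaarMeasure :=
    (PiLp.continuousLinearEquiv 2 ℝ (fun _ : Fin N => E n)).symm.isAddHaarMeasure_map volume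
  refine ⟨_, ?_, Measure.isAddLeftInvariant_eq_smul _ _⟩
  exact (Measure.addHaarScalarFactor_pos_of_isAddHaarMeasure _ _).ne'

/-- Fubini in the block variables. The constant is independent of the functions, and only its being
nonzero matters later. -/
theorem exists_integral_prod (N n : ℕ) : ∃ c : ℝ≥0, c ≠ 0 ∧
    (∀ f : Fin N → E n → ℂ, ∫ ξ : EN N n, ∏ k, f k (ξ k) = c * ∏ k, ∫ x, f k x) ∧
    (∀ f : Fin N → E n → ℝ, ∫ ξ : EN N n, ∏ k, f k (ξ k) = c * ∏ k, ∫ x, f k x) := by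
  obtain ⟨c, hc, h⟩ := exists_volume_eq_smul_map_toLp N n
  refine ⟨c, hc, fun f => ?_, fun f => ?_⟩ <;>
  · rw [h, integral_smul_nnreal_measure, ← MeasurableEquiv.coe_toLp, integral_map_equiv]
    simp only [MeasurableEquiv.coe_toLp]
    rw [integral_fintype_prod_volume_eq_prod, NNReal.smul_def]
    simp

theorem integrable_prod {𝕜 : Type*} [NormedCommRing 𝕜] {N n : ℕ} {f : Fin N → E n → 𝕜}
    (hf : ∀ k, Integrable (f k)) : Integrable (fun ξ : EN N n => ∏ k, f k (ξ k)) := by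
  obtain ⟨c, hc, h⟩ := exists_volume_eq_smul_map_toLp N n
  rw [h]
  refine Integrable.smul_measure_nnreal ?_
  rw [← MeasurableEquiv.coe_toLp, integrable_map_equiv]
  exact Integrable.fintype_prod hf

theorem lintegral_comp_inv_smul {n : ℕ} (g : E n → ℝ≥0∞) {r : ℝ} (hr : 0 < r) :
    ∫⁻ x, g (r⁻¹ • x) = ENNReal.ofReal (r ^ n) * ∫⁻ x, g x := by
  have h := lintegral_map_equiv (μ := (volume : Measure (E n))) g
    (Homeomorph.smulOfNeZero r⁻¹ (inv_ne_zero hr.ne')).toMeasurableEquiv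
  have h2 : (⇑(Homeomorph.smulOfNeZero (α := E n) r⁻¹ (inv_ne_zero hr.ne')).toMeasurableEquiv)
      = fun x => r⁻¹ • x := rfl
  rw [h2, Measure.map_addHaar_smul _ (inv_ne_zero hr.ne'), lintegral_smul_measure] at h
  rw [← h]
  simp [abs_of_pos hr]

theorem integral_comp_inv_smul {n : ℕ} {F : Type*} [NormedAddCommGroup F] [NormedSpace ℝ F]
    (g : E n → F) {r : ℝ} (hr : 0 < r) :
    ∫ x, g (r⁻¹ • x) = r ^ n • ∫ x, g x := by
  rw [Measure.integral_comp_smul]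
  simp [abs_of_pos hr]

theorem integral_comp_pos_smul {n : ℕ} {F : Type*} [NormedAddCommGroup F] [NormedSpace ℝ F]
    (g : E n → F) {r : ℝ} (hr : 0 < r) :
    ∫ x, g (r • x) = (r ^ n)⁻¹ • ∫ x, g x := by
  rw [Measure.integral_comp_smul]
  simp [abs_of_pos hr]

/-- Dilating a function dilates its Fourier transform. -/
theorem fourierTransform_comp_smul {n : ℕ} (g : E n → ℂ) {r : ℝ} (hr : 0 < r) (ξ : E n) :
    fourierTransform (fun x => g (r • x)) ξ = (r ^ n)⁻¹ • fourierTransform g (r⁻¹ • ξ) := by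
  rw [fourierTransform, fourierTransform, ← integral_comp_pos_smul _ hr]
  congr 1 with x
  rw [inner_smul_left, inner_smul_right]
  simp [hr.ne']

theorem fourierTransform_comp_inv_smul {n : ℕ} (g : E n → ℂ) {r : ℝ} (hr : 0 < r) (ξ : E n) :
    fourierTransform (fun x => g (r⁻¹ • x)) ξ = r ^ n • fourierTransform g (r • ξ) := by
  rw [fourierTransform_comp_smul g (inv_pos.2 hr)]
  simp

theorem exp_inner_eq_prod {N n : ℕ} (x ξ : EN N n) :
    Complex.exp (-(Complex.I * ((inner ℝ x ξ : ℝ) : ℂ))) =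
      ∏ k, Complex.exp (-(Complex.I * ((inner ℝ (x k) (ξ k) : ℝ) : ℂ))) := by
  rw [← Complex.exp_sum, PiLp.inner_apply, Finset.sum_neg_distrib, ← Finset.mul_sum]
  push_cast
  rfl

/-- The Fourier transform of a tensor product. -/
theorem exists_fourierTransform_prod (N n : ℕ) : ∃ c : ℝ≥0, c ≠ 0 ∧
    ∀ (f : Fin N → E n → ℂ) (ξ : EN N n),
      fourierTransform (fun x : EN N n => ∏ k, f k (x k)) ξ =
        c * ∏ k, fourierTransform (f k) (ξ k) := by
  obtain ⟨c, hc, h, -⟩ := exists_integral_prod N n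
  refine ⟨c, hc, fun f ξ => ?_⟩
  unfold fourierTransform
  rw [← h]
  congr 1 with x
  rw [exp_inner_eq_prod, Finset.prod_mul_distrib]

open FourierTransform in
/-- The Fourier transform of a product with a Schwartz function is a convolution. -/
theorem fourierTransform_mul_schwartz {V : Type*} [NormedAddCommGroup V] [InnerProductSpace ℝ V]
    [FiniteDimensional ℝ V] [MeasurableSpace V] [BorelSpace V] {θ : V → ℂ} (hθ : Integrable θ)
    (Ψ : 𝓢(V, ℂ)) (x : V) :
    fourierTransform (fun ξ => θ ξ * Ψ ξ) x =
      ∫ y, (𝓕 Ψ) y * fourierTransform θ (x - (2 * Real.pi) • y) := by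
  have hinv : ∀ ξ, Ψ ξ = ∫ y, Complex.exp (2 * Real.pi * Complex.I * ((inner ℝ y ξ : ℝ) : ℂ)) *
      (𝓕 Ψ) y := by
    intro ξ
    have h1 : Ψ ξ = (𝓕⁻ (𝓕 Ψ)) ξ := by rw [FourierPair.fourierInv_fourier_eq]
    rw [h1, SchwartzMap.fourierInv_coe, Real.fourierInv_eq]
    congr 1 with y
    rw [Circle.smul_def, Real.fourierChar_apply, smul_eq_mul]
    congr 2
    push_cast
    ring
  have hint : Integrable (Function.uncurry fun ξ y : V =>
      Complex.exp (-(Complex.I * ((inner ℝ ξ x : ℝ) : ℂ))) *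
        Complex.exp (2 * Real.pi * Complex.I * ((inner ℝ y ξ : ℝ) : ℂ)) * (θ ξ * (𝓕 Ψ) y))
      (volume.prod volume) := by
    -- The exponentials are unimodular, so `θ ⊗ 𝓕 Ψ` dominates and Fubini applies.
    refine (hθ.mul_prod (𝓕 Ψ).integrable).mono ?_ ?_
    · exact (by fun_prop : Continuous fun z : V × V =>
        Complex.exp (-(Complex.I * ((inner ℝ z.1 x : ℝ) : ℂ))) *
        Complex.exp (2 * Real.pi * Complex.I *
          ((inner ℝ z.2 z.1 : ℝ) : ℂ))).aestronglyMeasurable.mul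
        (hθ.mul_prod (𝓕 Ψ).integrable).aestronglyMeasurable
    · refine Filter.Eventually.of_forall fun z => ?_
      simp only [Function.uncurry]
      rw [norm_mul, norm_mul, Complex.norm_exp, Complex.norm_exp]
      simp
  calc fourierTransform (fun ξ => θ ξ * Ψ ξ) x
      = ∫ ξ, ∫ y, Complex.exp (-(Complex.I * ((inner ℝ ξ x : ℝ) : ℂ))) *
        Complex.exp (2 * Real.pi * Complex.I * ((inner ℝ y ξ : ℝ) : ℂ)) * (θ ξ * (𝓕 Ψ) y) := by
        unfold fourierTransform
        congr 1 with ξ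
        beta_reduce
        rw [hinv ξ, ← integral_const_mul, ← integral_const_mul]
        congr 1 with y
        ring
    _ = ∫ y, ∫ ξ, Complex.exp (-(Complex.I * ((inner ℝ ξ x : ℝ) : ℂ))) *
        Complex.exp (2 * Real.pi * Complex.I * ((inner ℝ y ξ : ℝ) : ℂ)) * (θ ξ * (𝓕 Ψ) y) :=
        integral_integral_swap hint
    _ = _ := by
        congr 1 with y
        rw [fourierTransform, ← integral_const_mul]
        congr 1 with ξ
        have hexp : -(Complex.I * ((inner ℝ ξ (x - (2 * Real.pi) • y) : ℝ) : ℂ)) =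
            -(Complex.I * ((inner ℝ ξ x : ℝ) : ℂ)) +
              2 * Real.pi * Complex.I * ((inner ℝ y ξ : ℝ) : ℂ) := by
          rw [inner_sub_right, inner_smul_right, real_inner_comm y ξ]
          push_cast
          ring
        rw [hexp, Complex.exp_add]
        ring

/-! ### Polynomial weights and weighted `L²` bounds on the Fourier side -/

theorem one_add_norm_sq_rpow_le {V : Type*} [NormedAddCommGroup V] (s : ℝ) :
    ∃ k : ℕ, ∀ x : V, (1 + ‖x‖ ^ 2) ^ s ≤ 2 ^ (k - 1) * (1 + ‖x‖ ^ (2 * k)) := by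
  refine ⟨⌈s⌉₊, fun x => ?_⟩
  calc (1 + ‖x‖ ^ 2) ^ s ≤ (1 + ‖x‖ ^ 2) ^ (⌈s⌉₊ : ℝ) :=
        Real.rpow_le_rpow_of_exponent_le (by nlinarith [sq_nonneg ‖x‖]) (Nat.le_ceil s)
    _ = (1 + ‖x‖ ^ 2) ^ ⌈s⌉₊ := Real.rpow_natCast _ _
    _ ≤ 2 ^ (⌈s⌉₊ - 1) * (1 ^ ⌈s⌉₊ + (‖x‖ ^ 2) ^ ⌈s⌉₊) := add_pow_le zero_le_one (by positivity) _
    _ = _ := by rw [one_pow, pow_mul]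

theorem continuous_one_add_norm_sq_rpow {V : Type*} [NormedAddCommGroup V] (s : ℝ) :
    Continuous fun x : V => (1 + ‖x‖ ^ 2) ^ s :=
  Continuous.rpow_const (by fun_prop) fun x => Or.inl (by positivity)

section Schwartz

variable {V : Type*} [NormedAddCommGroup V] [InnerProductSpace ℝ V]
  [FiniteDimensional ℝ V] [MeasurableSpace V] [BorelSpace V]

theorem integrable_rpow_mul_schwartz (f : 𝓢(V, ℂ)) (s : ℝ) :
    Integrable fun x => (1 + ‖x‖ ^ 2) ^ s * ‖f x‖ := by
  obtain ⟨k, hk⟩ := one_add_norm_sq_rpow_le (V := V) s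
  have h : Integrable fun x => (2 : ℝ) ^ (k - 1) * (‖f x‖ + ‖x‖ ^ (2 * k) * ‖f x‖) :=
    (f.integrable.norm.add (f.integrable_pow_mul volume (2 * k))).const_mul _
  refine h.mono' ((continuous_one_add_norm_sq_rpow s).mul
    f.continuous.norm).aestronglyMeasurable (Filter.Eventually.of_forall fun x => ?_)
  rw [Real.norm_of_nonneg (by positivity)]
  calc (1 + ‖x‖ ^ 2) ^ s * ‖f x‖ ≤ 2 ^ (k - 1) * (1 + ‖x‖ ^ (2 * k)) * ‖f x‖ := by
        gcongr; exact hk x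
    _ = _ := by ring

theorem integrable_rpow_mul_schwartz_sq (f : 𝓢(V, ℂ)) (s : ℝ) :
    Integrable fun x => (1 + ‖x‖ ^ 2) ^ s * ‖f x‖ ^ 2 := by
  refine ((integrable_rpow_mul_schwartz f s).mul_const
    (SchwartzMap.seminorm ℝ 0 0 f)).mono' ((continuous_one_add_norm_sq_rpow s).mul
    (f.continuous.norm.pow 2)).aestronglyMeasurable (Filter.Eventually.of_forall fun x => ?_)
  rw [Real.norm_of_nonneg (by positivity), sq ‖f x‖, ← mul_assoc]
  gcongr
  exact SchwartzMap.norm_le_seminorm ℝ f x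

theorem continuous_fourierTransform {f : V → ℂ} (hf : Integrable f) :
    Continuous (fourierTransform f) := by
  unfold fourierTransform
  refine continuous_of_dominated (bound := fun x => ‖f x‖) (fun ξ => ?_) (fun ξ => ?_)
    hf.norm (Filter.Eventually.of_forall fun x => by fun_prop)
  · exact (by fun_prop : Continuous fun x : V =>
      Complex.exp (-(Complex.I * ((inner ℝ x ξ : ℝ) : ℂ)))).aestronglyMeasurable.mul
        hf.aestronglyMeasurable
  · refine Filter.Eventually.of_forall fun x => ?_
    rw [norm_mul, Complex.norm_exp]
    simp

open FourierTransform in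
/-- The Fourier transform in the normalization without `2π` in the exponent, as a Schwartz
function. -/
theorem exists_schwartz_fourierTransform (f : 𝓢(V, ℂ)) :
    ∃ g : 𝓢(V, ℂ), ∀ ξ, g ξ = fourierTransform f ξ := by
  refine ⟨SchwartzMap.compCLMOfContinuousLinearEquiv ℝ
    (ContinuousLinearEquiv.smulLeft (Units.mk0 ((2 * Real.pi)⁻¹ : ℝ)
      (inv_ne_zero (by positivity)))) (𝓕 f), fun ξ => ?_⟩
  rw [fourierTransform_eq_fourier, ← SchwartzMap.fourier_coe]
  rfl

/-- Cauchy–Schwarz for the measure `a dμ`, after splitting `a = a^(1/2) a^(1/2)`. -/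
theorem sq_lintegral_mul_le {α : Type*} [MeasurableSpace α] {μ : Measure α} {a g : α → ℝ≥0∞}
    (ha : Measurable a) (hg : Measurable g) :
    (∫⁻ x, a x * g x ∂μ) ^ 2 ≤ (∫⁻ x, a x ∂μ) * ∫⁻ x, a x * g x ^ 2 ∂μ := by
  have h := ENNReal.lintegral_mul_le_Lp_mul_Lq μ Real.HolderConjugate.two_two
    (f := fun x => a x ^ (1 / 2 : ℝ)) (g := fun x => a x ^ (1 / 2 : ℝ) * g x)
    (by fun_prop) (by fun_prop)
  have hs : ∀ t : ℝ≥0∞, t ^ (1 / 2 : ℝ) * t ^ (1 / 2 : ℝ) = t := fun t => by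
    rw [← ENNReal.rpow_add_of_nonneg _ _ (by norm_num) (by norm_num)]
    norm_num
  have hs2 : ∀ t : ℝ≥0∞, (t ^ (1 / 2 : ℝ)) ^ 2 = t := fun t => by rw [sq, hs]
  simp only [Pi.mul_apply, ← mul_assoc, hs, ENNReal.rpow_two, mul_pow, hs2] at h
  calc _ ≤ _ := pow_le_pow_left' h 2
    _ = _ := by rw [mul_pow, hs2, hs2]

/-- A weighted `L²` bound for convolutions, for submultiplicative weights. -/
theorem lintegral_mul_sq_le_of_le_convolution {a w g G : V → ℝ≥0∞} {L : V → V} {D : ℝ≥0∞}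
    (ha : Measurable a) (hw : Measurable w) (hg : Measurable g) (hL : Measurable L)
    (hsub : ∀ x y, w (x + y) ≤ D * w x * w y) (hG : ∀ x, G x ≤ ∫⁻ y, a y * g (x - L y)) :
    ∫⁻ x, w x * G x ^ 2 ≤
      (D * (∫⁻ y, a y) * ∫⁻ y, a y * w (L y)) * ∫⁻ x, w x * g x ^ 2 := by
  calc ∫⁻ x, w x * G x ^ 2
      ≤ ∫⁻ x, ∫⁻ y, (∫⁻ y, a y) * (a y * (w x * g (x - L y) ^ 2)) := by
        refine lintegral_mono fun x => ?_
        rw [lintegral_const_mul _ (by fun_prop)]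
        calc w x * G x ^ 2
            ≤ w x * ((∫⁻ y, a y) * ∫⁻ y, a y * g (x - L y) ^ 2) := by
              gcongr
              exact (pow_le_pow_left' (hG x) 2).trans (sq_lintegral_mul_le ha (by fun_prop))
          _ = (∫⁻ y, a y) * (w x * ∫⁻ y, a y * g (x - L y) ^ 2) := by ring
          _ = _ := by
            rw [← lintegral_const_mul _ (by fun_prop)]
            congr 2 with y
            ring
    _ = ∫⁻ y, ∫⁻ x, (∫⁻ y, a y) * (a y * (w x * g (x - L y) ^ 2)) :=
        lintegral_lintegral_swap (by
          refine Measurable.aemeasurable ?_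
          unfold Function.uncurry
          fun_prop)
    _ ≤ ∫⁻ y, D * (∫⁻ y, a y) * (∫⁻ x, w x * g x ^ 2) * (a y * w (L y)) := by
        refine lintegral_mono fun y => ?_
        beta_reduce
        rw [lintegral_const_mul _ (by fun_prop), lintegral_const_mul _ (by fun_prop)]
        calc (∫⁻ y, a y) * (a y * ∫⁻ x, w x * g (x - L y) ^ 2)
            ≤ (∫⁻ y, a y) * (a y * ∫⁻ x, D * w (L y) *
                (w (x - L y) * g (x - L y) ^ 2)) := by
              refine mul_le_mul_right (mul_le_mul_right (lintegral_mono fun x => ?_) _) _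
              rw [← mul_assoc]
              gcongr
              simpa using hsub (L y) (x - L y)
          _ = _ := by
              -- Once the weight has been moved to `x - L y`, translation invariance removes the
              -- shift.
              rw [lintegral_sub_right_eq_self (fun x => D * w (L y) * (w x * g x ^ 2)),
                lintegral_const_mul _ (by fun_prop)]
              ring
    _ = _ := by
        rw [lintegral_const_mul _ (by fun_prop)]
        ring

open FourierTransform in
/-- Multiplication by a Schwartz function is bounded in a weighted `L²` norm on the Fourier side,
for submultiplicative weights. -/
theorem lintegral_fourierTransform_mul_schwartz_le {W : V → ℝ} (hW : Measurable W)
    (hW0 : ∀ x, 0 ≤ W x) {D : ℝ} (hD : 0 ≤ D) (hsub : ∀ x y, W (x + y) ≤ D * W x * W y)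
    (Ψ : 𝓢(V, ℂ)) {θ : V → ℂ} (hθ : Integrable θ) :
    ∫⁻ x, ENNReal.ofReal (W x * ‖fourierTransform (fun ξ => θ ξ * Ψ ξ) x‖ ^ 2) ≤
      (ENNReal.ofReal D * (∫⁻ y, ‖(𝓕 Ψ) y‖ₑ) *
        ∫⁻ y, ‖(𝓕 Ψ) y‖ₑ * ENNReal.ofReal (W ((2 * Real.pi) • y))) *
      ∫⁻ x, ENNReal.ofReal (W x * ‖fourierTransform θ x‖ ^ 2) := by
  have hof : ∀ (x : V) (z : ℂ), ENNReal.ofReal (W x * ‖z‖ ^ 2) =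
      ENNReal.ofReal (W x) * ‖z‖ₑ ^ 2 := fun x z => by
    rw [ENNReal.ofReal_mul (hW0 x), ENNReal.ofReal_pow (norm_nonneg _), ofReal_norm]
  simp only [hof]
  refine lintegral_mul_sq_le_of_le_convolution (𝓕 Ψ).continuous.enorm.measurable
    hW.ennreal_ofReal (continuous_fourierTransform hθ).enorm.measurable
    (L := fun y => (2 * Real.pi) • y) (by fun_prop) (fun x y => ?_) (fun x => ?_)
  · rw [← ENNReal.ofReal_mul hD, ← ENNReal.ofReal_mul (mul_nonneg hD (hW0 _))]
    exact ENNReal.ofReal_le_ofReal (hsub x y)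
  · rw [fourierTransform_mul_schwartz hθ]
    refine (enorm_integral_le_lintegral_enorm _).trans_eq ?_
    simp only [enorm_mul]

end Schwartz

/-! ### Multiplication by a Schwartz function on the product Sobolev space -/

/-- The weight of the Sobolev space of product type. -/
def sobolevWeight {N n : ℕ} (s : Fin N → ℝ) (x : EN N n) : ℝ := ∏ k, (1 + ‖x k‖ ^ 2) ^ s k

theorem sobolevWeight_pos {N n : ℕ} (s : Fin N → ℝ) (x : EN N n) : 0 < sobolevWeight s x :=
  Finset.prod_pos fun _ _ => by positivity

theorem continuous_sobolevWeight {N n : ℕ} (s : Fin N → ℝ) :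
    Continuous (sobolevWeight s : EN N n → ℝ) :=
  continuous_finsetProd _ fun k _ => (continuous_one_add_norm_sq_rpow (s k)).comp
    (by fun_prop : Continuous fun x : EN N n => x k)

/-- Peetre's inequality `1 + |x + y|² ≤ 2 (1 + |x|²)(1 + |y|²)` in each block. -/
theorem sobolevWeight_add_le {N n : ℕ} {s : Fin N → ℝ} (hs : ∀ k, 0 ≤ s k) (x y : EN N n) :
    sobolevWeight s (x + y) ≤ (∏ k, 2 ^ s k) * sobolevWeight s x * sobolevWeight s y := by
  unfold sobolevWeight
  rw [← Finset.prod_mul_distrib, ← Finset.prod_mul_distrib]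
  refine Finset.prod_le_prod (fun _ _ => by positivity) fun k _ => ?_
  rw [← Real.mul_rpow (by positivity) (by positivity),
    ← Real.mul_rpow (by positivity) (by positivity)]
  refine Real.rpow_le_rpow (by positivity) ?_ (hs k)
  have h := norm_add_le (x k) (y k)
  rw [PiLp.add_apply]
  calc 1 + ‖x k + y k‖ ^ 2 ≤ 1 + (‖x k‖ + ‖y k‖) ^ 2 := by gcongr
    _ ≤ _ := by nlinarith [sq_nonneg (‖x k‖ - ‖y k‖), sq_nonneg (‖x k‖ * ‖y k‖)]

theorem sobolevWeight_smul_le {N n : ℕ} {s : Fin N → ℝ} (hs : ∀ k, 0 ≤ s k) {b : ℝ} (hb : 1 ≤ b)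
    (x : EN N n) : sobolevWeight s (b • x) ≤ (b ^ 2) ^ (∑ k, s k) * (1 + ‖x‖ ^ 2) ^ (∑ k, s k) := by
  unfold sobolevWeight
  rw [← Real.mul_rpow (by positivity) (by positivity),
    Real.rpow_sum_of_pos (by positivity)]
  refine Finset.prod_le_prod (fun _ _ => by positivity) fun k _ => ?_
  refine Real.rpow_le_rpow (by positivity) ?_ (hs k)
  have h := PiLp.norm_apply_le x k
  have hb2 : 1 ≤ b ^ 2 := one_le_pow₀ hb
  rw [PiLp.smul_apply, norm_smul, Real.norm_of_nonneg (by linarith), mul_pow, mul_add, mul_one]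
  gcongr

-- This removes the cutoff `Ψ` from the dyadic pieces. The constant does not depend on `θ`, hence
-- neither on the dilation parameters nor on `j`. It is finite because `𝓕 Ψ` decays faster than the
-- weight grows.
open FourierTransform in
theorem exists_sobolevNorm_mul_schwartz_le {N n : ℕ} {s : Fin N → ℝ} (hs : ∀ k, 0 ≤ s k)
    (Ψ : 𝓢(EN N n, ℂ)) : ∃ K : ℝ≥0, ∀ θ : EN N n → ℂ, Integrable θ →
      sobolevNorm s (fun ξ => θ ξ * Ψ ξ) ≤ K * sobolevNorm s θ := by
  set A : ℝ≥0∞ := ENNReal.ofReal (∏ k, 2 ^ s k) * (∫⁻ y, ‖(𝓕 Ψ) y‖ₑ) *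
        ∫⁻ y, ‖(𝓕 Ψ) y‖ₑ * ENNReal.ofReal (sobolevWeight s ((2 * Real.pi) • y))
  have hAtop : A ≠ ∞ := by
    refine ENNReal.mul_ne_top (ENNReal.mul_ne_top ENNReal.ofReal_ne_top
      (𝓕 Ψ).integrable.2.ne) ?_
    refine ne_top_of_le_ne_top (((integrable_rpow_mul_schwartz (𝓕 Ψ) (∑ k, s k)).const_mul
      (((2 * Real.pi) ^ 2) ^ (∑ k, s k))).2.ne) (lintegral_mono fun y => ?_)
    rw [← ofReal_norm, ← ENNReal.ofReal_mul (norm_nonneg _), ← ofReal_norm]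
    refine ENNReal.ofReal_le_ofReal ?_
    rw [Real.norm_of_nonneg (by positivity), mul_comm]
    beta_reduce
    rw [← mul_assoc]
    gcongr
    exact sobolevWeight_smul_le hs (by linarith [Real.pi_gt_three]) y
  refine ⟨(A ^ (1 / 2 : ℝ)).toNNReal, fun θ hθ => ?_⟩
  rw [ENNReal.coe_toNNReal (ENNReal.rpow_ne_top_of_nonneg (by norm_num) hAtop), sobolevNorm,
    sobolevNorm, ← ENNReal.mul_rpow_of_nonneg _ _ (by norm_num)]
  gcongr
  exact lintegral_fourierTransform_mul_schwartz_le (continuous_sobolevWeight s).measurable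
    (fun x => (sobolevWeight_pos s x).le) (by positivity) (sobolevWeight_add_le hs) Ψ hθ

/-! ### Sobolev norms of dilated tensor products -/

/-- The dilate `x ↦ f (r x)` of a Schwartz function. -/
def dilate {n : ℕ} (r : ℝ) (hr : r ≠ 0) (f : 𝓢(E n, ℂ)) : 𝓢(E n, ℂ) :=
  SchwartzMap.compCLMOfContinuousLinearEquiv ℝ
    (ContinuousLinearEquiv.smulLeft (Units.mk0 r hr)) f

theorem coe_dilate {n : ℕ} (r : ℝ) (hr : r ≠ 0) (f : 𝓢(E n, ℂ)) :
    (dilate r hr f : E n → ℂ) = fun x => f (r • x) := rfl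

/-- The transform of `χ(r ·)` is `r^(-n) χ̂(· / r)`, so a change of variables leaves `r^(-n) ∫ (1 +
|r x|²)^s |χ̂|²`. The lower bound on `r` controls the first factor, and `1 + |r x|² ≤ (b R)² (1 +
|x|²)` the second. -/
theorem integral_rpow_mul_fourierTransform_dilate_le {n : ℕ} {s : ℝ} (hs : 0 ≤ s)
    (χ : 𝓢(E n, ℂ)) {a b : ℝ} (ha : 0 < a) (hb : 1 ≤ b) {R r : ℝ} (hR : 1 ≤ R)
    (har : a * R ≤ r) (hrb : r ≤ b * R) :
    ∫ x : E n, (1 + ‖x‖ ^ 2) ^ s * ‖fourierTransform (fun x => χ (r • x)) x‖ ^ 2 ≤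
      ((a ^ n)⁻¹ * (b ^ 2) ^ s * ∫ x : E n, (1 + ‖x‖ ^ 2) ^ s * ‖fourierTransform χ x‖ ^ 2) *
        (R ^ (s - n / 2)) ^ 2 := by
  have hR0 : 0 < R := by linarith
  have hr : 0 < r := lt_of_lt_of_le (by positivity) har
  obtain ⟨g, hg⟩ := exists_schwartz_fourierTransform χ
  have h1 : ∫ x : E n, (1 + ‖x‖ ^ 2) ^ s * ‖fourierTransform (fun x => χ (r • x)) x‖ ^ 2 =
      (r ^ n)⁻¹ * ∫ x : E n, (1 + ‖r • x‖ ^ 2) ^ s * ‖g x‖ ^ 2 := by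
    have := integral_comp_inv_smul (fun x : E n => (1 + ‖r • x‖ ^ 2) ^ s * ‖g x‖ ^ 2) hr
    rw [smul_eq_mul] at this
    rw [← mul_left_cancel_iff_of_pos (a := r ^ n * r ^ n) (by positivity), ← integral_const_mul,
      mul_assoc, mul_inv_cancel_left₀ (by positivity), ← this]
    congr 1 with x
    rw [fourierTransform_comp_smul _ hr, norm_smul, Real.norm_of_nonneg (by positivity), hg,
      smul_inv_smul₀ hr.ne', mul_pow]
    field_simp
  have h2 : ∫ x : E n, (1 + ‖r • x‖ ^ 2) ^ s * ‖g x‖ ^ 2 ≤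
      ((b * R) ^ 2) ^ s * ∫ x : E n, (1 + ‖x‖ ^ 2) ^ s * ‖g x‖ ^ 2 := by
    rw [← integral_const_mul]
    refine integral_mono_of_nonneg (Filter.Eventually.of_forall fun x => by positivity)
      ((integrable_rpow_mul_schwartz_sq g s).const_mul _)
      (Filter.Eventually.of_forall fun x => ?_)
    beta_reduce
    rw [← mul_assoc, ← Real.mul_rpow (by positivity) (by positivity)]
    gcongr
    rw [norm_smul, Real.norm_of_nonneg hr.le, mul_pow, mul_add, mul_one]
    have : 1 ≤ (b * R) ^ 2 := one_le_pow₀ (by nlinarith)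
    gcongr
  have h3 : (R ^ (s - n / 2)) ^ 2 = (R ^ n)⁻¹ * (R ^ 2) ^ s := by
    rw [← Real.rpow_natCast, ← Real.rpow_natCast R n, ← Real.rpow_natCast R 2, ← Real.rpow_mul hR0.le,
      ← Real.rpow_mul hR0.le, ← Real.rpow_neg hR0.le, ← Real.rpow_add hR0]
    congr 1
    push_cast
    ring
  simp only [hg] at h1 h2
  rw [h1, h3]
  calc _ ≤ ((a * R) ^ n)⁻¹ * (((b * R) ^ 2) ^ s *
        ∫ x : E n, (1 + ‖x‖ ^ 2) ^ s * ‖fourierTransform χ x‖ ^ 2) := by gcongr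
    _ = _ := by
      rw [mul_pow, mul_pow, Real.mul_rpow (by positivity) (by positivity), mul_inv]
      ring

/-- The Sobolev norm of a tensor product of dilates of a fixed Schwartz function. -/
theorem exists_sobolevNorm_prod_dilate_le {N n : ℕ} {s : Fin N → ℝ} (hs : ∀ k, 0 ≤ s k)
    (χ : 𝓢(E n, ℂ)) {a b : ℝ} (ha : 0 < a) (hb : 1 ≤ b) :
    ∃ K : ℝ≥0, ∀ R r : Fin N → ℝ, (∀ k, 1 ≤ R k) → (∀ k, a * R k ≤ r k) →
      (∀ k, r k ≤ b * R k) → sobolevNorm s (fun ξ : EN N n => ∏ k, χ (r k • ξ k)) ≤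
        K * ENNReal.ofReal (∏ k, R k ^ (s k - n / 2)) := by
  obtain ⟨c, -, hc⟩ := exists_fourierTransform_prod N n
  obtain ⟨c', -, -, hc'⟩ := exists_integral_prod N n
  set K : ℝ := (c : ℝ) ^ 2 * (c' * ∏ k, ((a ^ n)⁻¹ * (b ^ 2) ^ s k *
    ∫ x : E n, (1 + ‖x‖ ^ 2) ^ s k * ‖fourierTransform χ x‖ ^ 2)) with hK
  have hI : ∀ k, 0 ≤ ∫ x : E n, (1 + ‖x‖ ^ 2) ^ s k * ‖fourierTransform χ x‖ ^ 2 := fun k =>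
    integral_nonneg fun x => by positivity
  have hK0 : 0 ≤ K := mul_nonneg (by positivity) (mul_nonneg (by positivity)
    (Finset.prod_nonneg fun k _ => mul_nonneg (by positivity) (hI k)))
  refine ⟨(√K).toNNReal, fun R r hR har hrb => ?_⟩
  have hr : ∀ k, 0 < r k := fun k =>
    lt_of_lt_of_le (mul_pos ha (zero_lt_one.trans_le (hR k))) (har k)
  have hint : ∀ k, Integrable fun x : E n =>
      (1 + ‖x‖ ^ 2) ^ s k * ‖fourierTransform (fun x => χ (r k • x)) x‖ ^ 2 := fun k => by
    obtain ⟨g, hg⟩ := exists_schwartz_fourierTransform (dilate (r k) (hr k).ne' χ)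
    rw [coe_dilate] at hg
    simp only [← hg]
    exact integrable_rpow_mul_schwartz_sq g (s k)
  have heq : ∀ ξ : EN N n, (∏ k, (1 + ‖ξ k‖ ^ 2) ^ s k) *
      ‖fourierTransform (fun ξ : EN N n => ∏ k, χ (r k • ξ k)) ξ‖ ^ 2 =
      (c : ℝ) ^ 2 * ∏ k, ((1 + ‖ξ k‖ ^ 2) ^ s k *
        ‖fourierTransform (fun x => χ (r k • x)) (ξ k)‖ ^ 2) := fun ξ => by
    rw [hc (fun k x => χ (r k • x)) ξ, norm_mul, norm_prod, mul_pow, Finset.prod_mul_distrib,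
      Finset.prod_pow]
    simp
    ring
  rw [sobolevNorm]
  simp only [heq]
  rw [← ofReal_integral_eq_lintegral_ofReal ((integrable_prod hint).const_mul _)
    (Filter.Eventually.of_forall fun ξ => mul_nonneg (by positivity)
      (Finset.prod_nonneg fun k _ => by positivity)), integral_const_mul,
    hc' fun k x => (1 + ‖x‖ ^ 2) ^ s k * ‖fourierTransform (fun x => χ (r k • x)) x‖ ^ 2]
  have hR0 : ∀ k, 0 ≤ R k := fun k => zero_le_one.trans (hR k)
  have hP : 0 ≤ ∏ k, R k ^ (s k - n / 2) :=
    Finset.prod_nonneg fun k _ => Real.rpow_nonneg (hR0 k) _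
  calc _ ≤ ENNReal.ofReal (K * (∏ k, R k ^ (s k - n / 2)) ^ 2) ^ (1 / 2 : ℝ) := by
        refine ENNReal.rpow_le_rpow (ENNReal.ofReal_le_ofReal ?_) (by norm_num)
        rw [hK, ← Finset.prod_pow, mul_assoc, mul_assoc, ← Finset.prod_mul_distrib]
        refine mul_le_mul_of_nonneg_left (mul_le_mul_of_nonneg_left
          (Finset.prod_le_prod (fun k _ => ?_) fun k _ => ?_) (by positivity)) (by positivity)
        · exact integral_nonneg fun x => by positivity
        · exact integral_rpow_mul_fourierTransform_dilate_le (hs k) χ ha hb (hR k) (har k) (hrb k)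
    _ = _ := by
        rw [ENNReal.ofReal_rpow_of_nonneg (by positivity) (by norm_num), ← Real.sqrt_eq_rpow,
          Real.sqrt_mul hK0, Real.sqrt_sq hP, ENNReal.ofReal_mul (Real.sqrt_nonneg _)]
        rfl

theorem integrable_prod_dilate {N n : ℕ} (χ : 𝓢(E n, ℂ)) {r : Fin N → ℝ} (hr : ∀ k, r k ≠ 0) :
    Integrable fun ξ : EN N n => ∏ k, χ (r k • ξ k) :=
  integrable_prod (f := fun k x => χ (r k • x)) fun k => (dilate (r k) (hr k) χ).integrable

theorem sobolevNorm_zero {N n : ℕ} (s : Fin N → ℝ) : sobolevNorm s (fun _ : EN N n => 0) = 0 := by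
  simp [sobolevNorm, fourierTransform]

/-- The pieces of a tensor product multiplier, whose first factor is dilated by `R ≥ 1`. -/
theorem exists_iSup_sobolevNorm_dyadicPiece_le {N n : ℕ} {s : Fin N → ℝ} (hs : ∀ k, 0 ≤ s k)
    (χ : 𝓢(E n, ℂ)) {a b : ℝ} (ha : 0 < a) (hχ : ∀ x, χ x ≠ 0 → a ≤ ‖x‖ ∧ ‖x‖ ≤ b)
    {Ψ : 𝓢(EN N n, ℂ)} (hΨ : IsDyadicPartition Ψ) :
    ∃ K : ℝ≥0, ∀ R : Fin N → ℝ, (∀ k, 1 ≤ R k) → (∃ k, R k = 1) →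
      ⨆ j : ℤ, sobolevNorm s (dyadicPiece Ψ (fun ξ => ∏ k, χ (R k • ξ k)) j) ≤
        K * ENNReal.ofReal (∏ k, R k ^ (s k - n / 2)) := by
  obtain ⟨K₁, hK₁⟩ := exists_sobolevNorm_mul_schwartz_le hs Ψ
  obtain ⟨K₂, hK₂⟩ := exists_sobolevNorm_prod_dilate_le (N := N) hs χ (half_pos ha)
    (le_max_left 1 (2 * N * b))
  refine ⟨K₁ * K₂, fun R hR ⟨i, hi⟩ => iSup_le fun j => ?_⟩
  have h2j : (0 : ℝ) < 2 ^ j := by positivity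
  have hpiece : dyadicPiece Ψ (fun ξ => ∏ k, χ (R k • ξ k)) j =
      fun ξ => (∏ k, χ ((2 ^ j * R k) • ξ k)) * Ψ ξ := by
    ext ξ
    simp only [dyadicPiece, PiLp.smul_apply, smul_smul, mul_comm]
  rw [hpiece]
  -- A nonvanishing piece confines `2^j` to a fixed compact interval of positive numbers: the block
  -- with `R i = 1` gives the lower bound, and `‖ξ‖ ≥ 1/2` together with `R k ≥ 1` the upper one.
  -- Then `2^j R k` is comparable to `R k`.
  by_cases hz : ∀ ξ, (∏ k, χ ((2 ^ j * R k) • ξ k)) * Ψ ξ = 0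
  · simp only [hz, sobolevNorm_zero]
    exact zero_le
  push Not at hz
  obtain ⟨ξ, hξ⟩ := hz
  have hΨξ := hΨ.support_subset (subset_tsupport _ (right_ne_zero_of_mul hξ))
  have hχξ : ∀ k, a ≤ 2 ^ j * R k * ‖ξ k‖ ∧ 2 ^ j * R k * ‖ξ k‖ ≤ b := fun k => by
    have h := hχ _ (Finset.prod_ne_zero_iff.1 (left_ne_zero_of_mul hξ) k (Finset.mem_univ k))
    rwa [norm_smul, Real.norm_of_nonneg (by have := hR k; positivity)] at h
  have hlow : a / 2 ≤ 2 ^ j := by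
    have h1 := (hχξ i).1
    have h2 := (PiLp.norm_apply_le ξ i).trans hΨξ.2
    rw [hi, mul_one] at h1
    nlinarith
  have hup : (2 : ℝ) ^ j ≤ 2 * N * b := by
    have h1 : ‖ξ‖ ≤ ∑ k, ‖ξ k‖ := by
      rw [PiLp.norm_eq_of_L2]
      exact Real.sqrt_le_iff.2 ⟨by positivity, Finset.sum_sq_le_sq_sum_of_nonneg fun k _ => norm_nonneg _⟩
    have h2 : 2 ^ j * ∑ k, ‖ξ k‖ ≤ N * b := by
      rw [Finset.mul_sum]
      calc _ ≤ ∑ _k : Fin N, b := Finset.sum_le_sum fun k _ => ?_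
        _ = _ := by simp
      refine le_trans ?_ (hχξ k).2
      gcongr
      exact le_mul_of_one_le_right h2j.le (hR k)
    have h3 := hΨξ.1
    nlinarith
  have hr : ∀ k, 2 ^ j * R k ≠ 0 := fun k => (mul_pos h2j (zero_lt_one.trans_le (hR k))).ne'
  calc _ ≤ K₁ * sobolevNorm s (fun ξ : EN N n => ∏ k, χ ((2 ^ j * R k) • ξ k)) :=
        hK₁ _ (integrable_prod_dilate χ hr)
    _ ≤ K₁ * (K₂ * ENNReal.ofReal (∏ k, R k ^ (s k - n / 2))) := by
        gcongr
        have hR0 : ∀ k, 0 ≤ R k := fun k => zero_le_one.trans (hR k)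
        refine hK₂ R _ hR (fun k => ?_) (fun k => ?_)
        · exact mul_le_mul_of_nonneg_right hlow (hR0 k)
        · exact mul_le_mul_of_nonneg_right (hup.trans (le_max_right _ _)) (hR0 k)
    _ = _ := by
        push_cast
        ring

/-! ### The operator on dilated test functions, and the choice of `χ` and `φ` -/

/-- The inverse Fourier transform of `χ φ̂`, up to a constant factor. -/
def profile {n : ℕ} (χ φ : 𝓢(E n, ℂ)) (x : E n) : ℂ :=
  ∫ η : E n, Complex.exp (Complex.I * ((inner ℝ x η : ℝ) : ℂ)) * (χ η * fourierTransform φ η)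

theorem continuous_profile {n : ℕ} (χ φ : 𝓢(E n, ℂ)) : Continuous (profile χ φ) := by
  obtain ⟨g, hg⟩ := exists_schwartz_fourierTransform φ
  have hint : Integrable fun η => χ η * fourierTransform φ η := by
    simp only [← hg]
    exact g.integrable.bdd_mul (c := SchwartzMap.seminorm ℝ 0 0 χ)
      χ.continuous.aestronglyMeasurable
      (Filter.Eventually.of_forall fun x => SchwartzMap.norm_le_seminorm ℝ χ x)
  have heq : profile χ φ = fun x => fourierTransform (fun η => χ η * fourierTransform φ η) (-x) := by
    ext x
    simp only [profile, fourierTransform, inner_neg_right]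
    congr 1 with η
    rw [real_inner_comm]
    simp
  rw [heq]
  exact (continuous_fourierTransform hint).comp continuous_neg

/-- The action of a tensor product multiplier on adapted dilates of a fixed function. -/
theorem exists_multiplierOp_prod_dilate (N n : ℕ) : ∃ K : ℂ, K ≠ 0 ∧
    ∀ (χ φ : 𝓢(E n, ℂ)) (R : Fin N → ℝ), (∀ k, 0 < R k) → ∀ f : Fin N → 𝓢(E n, ℂ),
      (∀ k, (f k : E n → ℂ) = fun x => φ ((R k)⁻¹ • x)) → ∀ x,
      multiplierOp (fun ξ : EN N n => ∏ k, χ (R k • ξ k)) f x =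
        K * ∏ k, profile χ φ ((R k)⁻¹ • x) := by
  obtain ⟨c, hc0, hc, -⟩ := exists_integral_prod N n
  refine ⟨1 / (2 * (Real.pi : ℂ)) ^ (N * n) * c, ?_, fun χ φ R hR f hf x => ?_⟩
  · simp [hc0, Real.pi_ne_zero]
  have hfac : ∀ ξ : EN N n, Complex.exp (Complex.I * ((inner ℝ x (∑ k, ξ k) : ℝ) : ℂ)) *
      (∏ k, χ (R k • ξ k)) * ∏ k, fourierTransform (f k) (ξ k) =
      ∏ k, (Complex.exp (Complex.I * ((inner ℝ x (ξ k) : ℝ) : ℂ)) * χ (R k • ξ k) *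
        fourierTransform (f k) (ξ k)) := fun ξ => by
    rw [Finset.prod_mul_distrib, Finset.prod_mul_distrib, ← Complex.exp_sum, inner_sum,
      ← Finset.mul_sum]
    push_cast
    rfl
  simp only [multiplierOp, hfac]
  rw [hc fun k η => Complex.exp (Complex.I * ((inner ℝ x η : ℝ) : ℂ)) * χ (R k • η) *
        fourierTransform (f k) η, ← mul_assoc]
  congr 2 with k
  have h := integral_comp_pos_smul (fun η : E n => Complex.exp (Complex.I *
    ((inner ℝ ((R k)⁻¹ • x) η : ℝ) : ℂ)) * (χ η * fourierTransform φ η)) (hR k)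
  have hRk := (pow_pos (hR k) n).ne'
  change _ = _ • profile χ φ ((R k)⁻¹ • x) at h
  rw [← inv_smul_eq_iff₀ (inv_ne_zero hRk), inv_inv] at h
  rw [← h, ← integral_smul]
  congr 1 with η
  rw [hf, fourierTransform_comp_inv_smul _ (hR k), inner_smul_left, inner_smul_right]
  simp only [Complex.real_smul, map_inv₀, conj_trivial, inv_mul_cancel_left₀ (hR k).ne']
  ring

theorem exists_schwartz_bump {V : Type*} [NormedAddCommGroup V] [InnerProductSpace ℝ V]
    [FiniteDimensional ℝ V] [MeasurableSpace V] [BorelSpace V] [Nontrivial V] {ρ : ℝ}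
    (hρ : 0 < ρ) : ∃ (b : V → ℝ) (f : 𝓢(V, ℂ)), (∀ x, f x = b x) ∧ (∀ x, 0 ≤ b x) ∧
      (∀ x, b x ≠ 0 → ρ ≤ ‖x‖ ∧ ‖x‖ ≤ 3 * ρ) ∧ HasCompactSupport b ∧ Continuous b ∧ b ≠ 0 := by
  obtain ⟨c, hc⟩ := exists_norm_eq V (c := 2 * ρ) (by positivity)
  let b : ContDiffBump c := ⟨ρ / 2, ρ, by positivity, by linarith⟩
  have hb : ∀ x, b x ≠ 0 → ρ ≤ ‖x‖ ∧ ‖x‖ ≤ 3 * ρ := fun x hx => by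
    have h : x ∈ Metric.ball c ρ := b.support_eq ▸ hx
    rw [mem_ball_iff_norm] at h
    have h1 := norm_sub_norm_le c x
    have h2 := norm_sub_norm_le x c
    rw [norm_sub_rev] at h1
    constructor <;> linarith
  have hcs : HasCompactSupport fun x => (b x : ℂ) :=
    b.hasCompactSupport.comp_left (g := fun t : ℝ => (t : ℂ)) Complex.ofReal_zero
  refine ⟨b, hcs.toSchwartzMap (Complex.ofRealCLM.contDiff.comp b.contDiff), fun x => rfl,
    fun x => b.nonneg, hb, b.hasCompactSupport, b.continuous, fun h => ?_⟩
  have h1 : b c = 1 := b.one_of_mem_closedBall (by simp [b.rIn_pos.le])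
  simp [h] at h1

/-- Take `φ ≥ 0` nonzero, so that `φ̂(0) > 0`, and `χ ≥ 0` supported where `Re φ̂` is still
positive; then `Re ∫ χ φ̂ > 0`. Keeping `φ` away from the origin makes its weighted norms finite
even for nonintegrable powers, and keeping `χ` away from it localizes the multiplier in frequency.
-/
theorem exists_schwartz_pair {n : ℕ} (hn : n ≠ 0) : ∃ (χ φ : 𝓢(E n, ℂ)) (a b : ℝ), 0 < a ∧
    (∀ x, χ x ≠ 0 → a ≤ ‖x‖ ∧ ‖x‖ ≤ b) ∧ (∀ x, φ x ≠ 0 → 1 ≤ ‖x‖ ∧ ‖x‖ ≤ 3) ∧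
    profile χ φ 0 ≠ 0 := by
  have : Nonempty (Fin n) := ⟨⟨0, Nat.pos_of_ne_zero hn⟩⟩
  obtain ⟨u, φ, hφu, hu0, hus, huc, hucont, hune⟩ := exists_schwartz_bump (V := E n) one_pos
  have hcont := continuous_fourierTransform φ.integrable
  have hpos : 0 < (fourierTransform φ 0).re := by
    have h : fourierTransform φ 0 = ((∫ x, u x : ℝ) : ℂ) := by
      simp only [fourierTransform, hφu]
      rw [← integral_complex_ofReal]
      simp
    rw [h, Complex.ofReal_re]
    exact hucont.integral_pos_of_hasCompactSupport_nonneg_nonzero huc hu0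
      (x := (Function.ne_iff.1 hune).choose) (Function.ne_iff.1 hune).choose_spec
  obtain ⟨δ, hδ, hball⟩ := Metric.eventually_nhds_iff.1
    ((Complex.continuous_re.comp hcont).continuousAt.eventually (lt_mem_nhds hpos))
  -- With `ρ = δ / 4` the bump lives in `‖x‖ ≤ 3δ/4 < δ`, where `Re φ̂ > 0`.
  obtain ⟨v, χ, hχv, hv0, hvs, hvc, hvcont, hvne⟩ :=
    exists_schwartz_bump (V := E n) (show 0 < δ / 4 by positivity)
  have hre : ∀ η, 0 ≤ v η * (fourierTransform φ η).re := fun η => by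
    by_cases hη : v η = 0
    · simp [hη]
    · have h := hball (y := η) (by rw [dist_zero_right]; linarith [(hvs η hη).2])
      exact mul_nonneg (hv0 η) h.le
  refine ⟨χ, φ, δ / 4, 3 * (δ / 4), by positivity, fun x hx => hvs x ?_, fun x hx => ?_, ?_⟩
  · intro h
    simp [hχv, h] at hx
  · have h := hus x (by
      intro h
      simp [hφu, h] at hx)
    simpa using h
  · intro h
    have hcs : HasCompactSupport fun η => v η * (fourierTransform φ η).re := hvc.mul_right
    have hct : Continuous fun η => v η * (fourierTransform φ η).re :=
      hvcont.mul (Complex.continuous_re.comp hcont)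
    have hint : Integrable fun η => χ η * fourierTransform φ η := by
      have h1 : Continuous fun η => (v η : ℂ) * fourierTransform φ η := by fun_prop
      have h2 : HasCompactSupport fun η => (v η : ℂ) :=
        hvc.comp_left (g := fun t : ℝ => (t : ℂ)) Complex.ofReal_zero
      simp only [hχv]
      exact h1.integrable_of_hasCompactSupport h2.mul_right
    have h1 : (profile χ φ 0).re = ∫ η, v η * (fourierTransform φ η).re := by
      simp only [profile, inner_zero_left, Complex.ofReal_zero, mul_zero, Complex.exp_zero, one_mul]
      change RCLike.re (∫ η, χ η * fourierTransform φ η) = _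
      rw [← integral_re hint]
      congr 1 with η
      simp [hχv]
    obtain ⟨η, hη⟩ := Function.ne_iff.1 hvne
    have h2 : 0 < ∫ η, v η * (fourierTransform φ η).re := by
      refine hct.integral_pos_of_hasCompactSupport_nonneg_nonzero hcs hre (x := η) ?_
      have h := hball (y := η) (by rw [dist_zero_right]; linarith [(hvs η hη).2])
      exact mul_ne_zero hη h.ne'
    rw [← h1, h] at h2
    simp at h2

/-! ### Weighted norms: scaling, finiteness and lower bounds -/

theorem weightedNorm_comp_inv_smul {n : ℕ} {p α r : ℝ} (hp : 0 < p) (hr : 0 < r) (f : E n → ℂ) :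
    weightedNorm p (fun x => ‖x‖ ^ α) (fun x => f (r⁻¹ • x)) =
      ENNReal.ofReal (r ^ ((n + α) / p)) * weightedNorm p (fun x => ‖x‖ ^ α) f := by
  have h := lintegral_comp_inv_smul (fun x : E n => ‖f x‖ₑ ^ p * ENNReal.ofReal (‖r • x‖ ^ α)) hr
  simp only [smul_inv_smul₀ hr.ne'] at h
  have h2 : ∫⁻ x : E n, ‖f x‖ₑ ^ p * ENNReal.ofReal (‖r • x‖ ^ α) =
      ENNReal.ofReal (r ^ α) * ∫⁻ x : E n, ‖f x‖ₑ ^ p * ENNReal.ofReal (‖x‖ ^ α) := by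
    rw [← lintegral_const_mul' _ _ ENNReal.ofReal_ne_top]
    congr 1 with x
    rw [norm_smul, Real.norm_of_nonneg hr.le, Real.mul_rpow hr.le (norm_nonneg _),
      ENNReal.ofReal_mul (by positivity)]
    ring
  rw [weightedNorm, h, h2, ← mul_assoc, ← ENNReal.ofReal_mul (by positivity),
    ENNReal.mul_rpow_of_nonneg _ _ (by positivity), weightedNorm,
    ENNReal.ofReal_rpow_of_nonneg (by positivity) (by positivity), ← Real.rpow_natCast,
    ← Real.rpow_add hr, ← Real.rpow_mul hr.le]
  congr 4
  ring

theorem weightedNorm_lt_top {n : ℕ} {p α : ℝ} (hp : 0 < p) (φ : 𝓢(E n, ℂ)) {b : ℝ}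
    (hφ : ∀ x, φ x ≠ 0 → 1 ≤ ‖x‖ ∧ ‖x‖ ≤ b) :
    weightedNorm p (fun x => ‖x‖ ^ α) φ < ∞ := by
  refine ENNReal.rpow_lt_top_of_nonneg (by positivity) (ne_of_lt ?_)
  set M := SchwartzMap.seminorm ℝ 0 0 φ
  calc ∫⁻ x, ‖φ x‖ₑ ^ p * ENNReal.ofReal (‖x‖ ^ α)
      ≤ ∫⁻ x, (Metric.closedBall (0 : E n) b).indicator
          (fun _ => ENNReal.ofReal M ^ p * ENNReal.ofReal (b ^ |α|)) x := by
        refine lintegral_mono fun x => ?_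
        by_cases hx : φ x = 0
        · simp [hx, hp]
        · obtain ⟨h1, h2⟩ := hφ x hx
          rw [Set.indicator_of_mem (by simpa using h2)]
          gcongr
          · rw [← ofReal_norm]
            exact ENNReal.ofReal_le_ofReal (SchwartzMap.norm_le_seminorm ℝ φ x)
          · calc ‖x‖ ^ α ≤ ‖x‖ ^ |α| := Real.rpow_le_rpow_of_exponent_le h1 (le_abs_self α)
              _ ≤ b ^ |α| := Real.rpow_le_rpow (norm_nonneg _) h2 (abs_nonneg α)
    _ = ENNReal.ofReal M ^ p * ENNReal.ofReal (b ^ |α|) *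
          volume (Metric.closedBall (0 : E n) b) := by
        rw [lintegral_indicator Metric.isClosed_closedBall.measurableSet, setLIntegral_const]
    _ < ∞ := ENNReal.mul_lt_top (ENNReal.mul_lt_top
        (ENNReal.rpow_lt_top_of_nonneg hp.le ENNReal.ofReal_ne_top) ENNReal.ofReal_lt_top)
        measure_closedBall_lt_top

/-- The bound `ε` is chosen before `g`, so it serves all `T_m(f)` as `R` varies. -/
theorem weightedNorm_pos_of_le_norm {n : ℕ} {p δ c : ℝ} (hp : 0 < p) (hδ : 0 < δ) (hc : 0 < c)
    {ν : E n → ℝ} (hν : Measurable ν) (hν0 : ∀ᵐ x, 0 < ν x) :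
    ∃ ε : ℝ≥0∞, 0 < ε ∧ ∀ g : E n → ℂ, (∀ x, ‖x‖ < δ → c ≤ ‖g x‖) → ε ≤ weightedNorm p ν g := by
  refine ⟨(∫⁻ x in Metric.ball 0 δ, ENNReal.ofReal c ^ p * ENNReal.ofReal (ν x)) ^ (1 / p),
    ENNReal.rpow_pos_of_nonneg ?_ (by positivity), fun g hg => ?_⟩
  · rw [pos_iff_ne_zero, Ne, lintegral_eq_zero_iff (by fun_prop)]
    intro h
    have h2 : ∀ᵐ x ∂(volume.restrict (Metric.ball (0 : E n) δ)), False := by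
      filter_upwards [h, ae_restrict_of_ae hν0] with x hx hx2
      rw [← ENNReal.ofReal_pos] at hx2
      exact mul_ne_zero (ENNReal.rpow_pos (ENNReal.ofReal_pos.2 hc) ENNReal.ofReal_ne_top).ne'
        hx2.ne' hx
    rw [Filter.eventually_false_iff_eq_bot, ae_eq_bot, Measure.restrict_eq_zero] at h2
    exact (Metric.measure_ball_pos volume (0 : E n) hδ).ne' h2
  · refine ENNReal.rpow_le_rpow ?_ (by positivity)
    refine (setLIntegral_mono' Metric.isOpen_ball.measurableSet fun x hx => ?_).trans
      (setLIntegral_le_lintegral _ _)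
    gcongr
    rw [← ofReal_norm]
    exact ENNReal.ofReal_le_ofReal (hg x (by simpa using hx))

/-! ### Power weights and the class `A_{P/Q}` -/

theorem volume_cube {n : ℕ} (a : E n) {r : ℝ} (hr : 0 < r) :
    volume (cube a r) = ENNReal.ofReal (r ^ n) := by
  have h : cube a r = WithLp.ofLp ⁻¹' Set.Icc (fun i => a i) (fun i => a i + r) := by
    ext x
    simp only [cube, Set.mem_ofPred_eq, Set.mem_preimage, Set.mem_Icc, Pi.le_def, forall_and]
  rw [h, (PiLp.volume_preserving_ofLp (Fin n)).measure_preimage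
    measurableSet_Icc.nullMeasurableSet, Real.volume_Icc_pi]
  simp [ENNReal.ofReal_pow hr.le]

theorem measurableSet_cube {n : ℕ} (a : E n) (r : ℝ) : MeasurableSet (cube a r) := by
  have : cube a r = ⋂ i, {x : E n | a i ≤ x i ∧ x i ≤ a i + r} := by
    ext x
    simp [cube]
  rw [this]
  refine MeasurableSet.iInter fun i => IsClosed.measurableSet ?_
  have hc : Continuous fun x : E n => x i := by fun_prop
  exact (isClosed_le continuous_const hc).inter (isClosed_le hc continuous_const)

theorem norm_sub_le_of_mem_cube {n : ℕ} {a x : E n} {r : ℝ} (hx : x ∈ cube a r) :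
    ‖x - a‖ ≤ n * r := by
  have h1 : ‖x - a‖ ≤ ∑ k, ‖(x - a) k‖ := by
    rw [EuclideanSpace.norm_eq]
    exact Real.sqrt_le_iff.2 ⟨by positivity,
      Finset.sum_sq_le_sq_sum_of_nonneg fun k _ => norm_nonneg _⟩
  calc _ ≤ _ := h1
    _ ≤ ∑ _k : Fin n, r := Finset.sum_le_sum fun k _ => by
      rw [PiLp.sub_apply, Real.norm_eq_abs, abs_le]
      constructor <;> linarith [(hx k).1, (hx k).2]
    _ = _ := by simp

/-- Adding the powers of both endpoints covers either sign of `γ` at once. -/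
theorem rpow_le_of_mem_Icc {t ρ lo hi : ℝ} (γ : ℝ) (hlo : 0 < lo) (hρ : 0 < ρ) (h1 : lo * ρ ≤ t)
    (h2 : t ≤ hi * ρ) : t ^ γ ≤ (lo ^ γ + hi ^ γ) * ρ ^ γ := by
  have hlr : 0 < lo * ρ := by positivity
  have ht : 0 < t := hlr.trans_le h1
  have hhi : 0 < hi := pos_of_mul_pos_left (ht.trans_le h2) hρ.le
  rw [add_mul, ← Real.mul_rpow hlo.le hρ.le, ← Real.mul_rpow hhi.le hρ.le]
  rcases le_total 0 γ with hγ | hγ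
  · have := Real.rpow_le_rpow ht.le h2 hγ
    have : 0 ≤ (lo * ρ) ^ γ := by positivity
    linarith
  · have := Real.rpow_le_rpow_of_nonpos hlr h1 hγ
    have : 0 ≤ (hi * ρ) ^ γ := by positivity
    linarith

theorem setLIntegral_ball_norm_rpow {n : ℕ} (γ : ℝ) {R : ℝ} (hR : 0 < R) :
    ∫⁻ x in Metric.ball (0 : E n) R, ENNReal.ofReal (‖x‖ ^ γ) =
      ENNReal.ofReal (R ^ (n + γ)) *
        ∫⁻ x in Metric.ball (0 : E n) 1, ENNReal.ofReal (‖x‖ ^ γ) := by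
  rw [← lintegral_indicator Metric.isOpen_ball.measurableSet,
    ← lintegral_indicator Metric.isOpen_ball.measurableSet, Real.rpow_add hR,
    ENNReal.ofReal_mul (by positivity), Real.rpow_natCast, mul_assoc,
    ← lintegral_const_mul' _ _ ENNReal.ofReal_ne_top, ← lintegral_comp_inv_smul _ hR]
  congr 1 with x
  have h : R⁻¹ • x ∈ Metric.ball (0 : E n) 1 ↔ x ∈ Metric.ball (0 : E n) R := by
    rw [mem_ball_zero_iff, mem_ball_zero_iff, norm_smul, norm_inv, Real.norm_of_nonneg hR.le,
      inv_mul_lt_iff₀ hR, mul_one]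
  by_cases hx : x ∈ Metric.ball (0 : E n) R
  · rw [Set.indicator_of_mem hx, Set.indicator_of_mem (h.2 hx),
      ← ENNReal.ofReal_mul (by positivity), norm_smul, norm_inv, Real.norm_of_nonneg hR.le,
      ← Real.mul_rpow hR.le (by positivity), mul_inv_cancel_left₀ hR.ne']
  · rw [Set.indicator_of_notMem hx, Set.indicator_of_notMem (fun h' => hx (h.1 h')), mul_zero]

theorem setLIntegral_ball_norm_rpow_lt_top {n : ℕ} (hn : n ≠ 0) {γ : ℝ} (hγ : -(n : ℝ) < γ) :
    ∫⁻ x in Metric.ball (0 : E n) 1, ENNReal.ofReal (‖x‖ ^ γ) < ∞ := by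
  have : Nonempty (Fin n) := ⟨⟨0, Nat.pos_of_ne_zero hn⟩⟩
  have h : IntegrableOn (fun x : E n => ‖x‖ ^ γ) (Metric.ball (0 : E n) 1) := by
    rw [integrableOn_fun_norm_addHaar volume (f := fun y : ℝ => y ^ γ), finrank_euclideanSpace_fin]
    have h2 : IntegrableOn (fun y : ℝ => y ^ ((n : ℝ) - 1 + γ)) (Set.Ioo 0 1) :=
      (intervalIntegral.integrableOn_Ioo_rpow_iff one_pos).2 (by linarith)
    refine h2.congr_fun (fun y hy => ?_) measurableSet_Ioo
    beta_reduce
    rw [smul_eq_mul, Real.rpow_add hy.1, ← Real.rpow_natCast, Nat.cast_pred (Nat.pos_of_ne_zero hn)]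
  exact h.lintegral_lt_top

theorem setLAverage_le_of_forall_le {α : Type*} [MeasurableSpace α] {μ : Measure α} {s : Set α}
    (hs : MeasurableSet s) {f : α → ℝ≥0∞} {c : ℝ≥0∞} (h : ∀ x ∈ s, f x ≤ c) :
    ⨍⁻ x in s, f x ∂μ ≤ c := by
  rw [setLAverage_eq]
  refine ENNReal.div_le_of_le_mul ?_
  calc _ ≤ ∫⁻ _ in s, c ∂μ := setLIntegral_mono' hs h
    _ = _ := setLIntegral_const _ _

/-- Averages of power weights over cubes. -/
theorem exists_setLAverage_cube_norm_rpow_le {n : ℕ} (hn : n ≠ 0) {γ : ℝ} (hγ : -(n : ℝ) < γ) :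
    ∃ C : ℝ≥0, ∀ (a : E n) (r : ℝ), 0 < r →
      ⨍⁻ x in cube a r, ENNReal.ofReal (‖x‖ ^ γ) ∂volume ≤ C * ENNReal.ofReal ((‖a‖ + r) ^ γ) := by
  have hn1 : (1 : ℝ) ≤ n := by exact_mod_cast Nat.one_le_iff_ne_zero.2 hn
  set I := ∫⁻ x in Metric.ball (0 : E n) 1, ENNReal.ofReal (‖x‖ ^ γ)
  have hItop : I ≠ ∞ := (setLIntegral_ball_norm_rpow_lt_top hn hγ).ne
  set C₁ : ℝ := (1 / 4) ^ γ + n ^ γ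
  set C₂ : ℝ := (1 / (2 * n + 1)) ^ γ + 1 ^ γ
  refine ⟨C₁.toNNReal + (4 * n : ℝ).toNNReal ^ (n + γ) * I.toNNReal * C₂.toNNReal,
    fun a r hr => ?_⟩
  have hρ : 0 < ‖a‖ + r := by positivity
  have hnr : r ≤ n * r := le_mul_of_one_le_left hr.le hn1
  have hn4 : (4 * n : ℝ).toNNReal ≠ 0 := by
    rw [Ne, Real.toNNReal_eq_zero, not_le]
    positivity
  rw [ENNReal.coe_add, add_mul]
  -- On a cube far from the origin, `‖x‖` is comparable to `‖a‖ + r`. Otherwise the cube lies in the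
  -- ball of radius `4 n r` about the origin, `r` itself is comparable to `‖a‖ + r`, and scaling
  -- with `γ > -n` gives the bound.
  rcases le_total (2 * n * r) ‖a‖ with h | h
  · refine le_trans (setLAverage_le_of_forall_le (measurableSet_cube a r) fun x hx => ?_)
      le_self_add
    have h1 := norm_sub_le_of_mem_cube hx
    have h2 := norm_sub_norm_le x a
    have h3 := norm_sub_norm_le a x
    rw [norm_sub_rev] at h3
    rw [ENNReal.ofNNReal_toNNReal, ← ENNReal.ofReal_mul (by positivity)]
    refine ENNReal.ofReal_le_ofReal (rpow_le_of_mem_Icc γ (by norm_num) hρ ?_ ?_)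
    · linarith
    · nlinarith [norm_nonneg a]
  · refine le_trans ?_ le_add_self
    rw [setLAverage_eq, volume_cube a hr]
    refine ENNReal.div_le_of_le_mul ?_
    calc ∫⁻ x in cube a r, ENNReal.ofReal (‖x‖ ^ γ)
        ≤ ∫⁻ x in Metric.ball (0 : E n) (4 * n * r), ENNReal.ofReal (‖x‖ ^ γ) := by
          refine lintegral_mono_set fun x hx => ?_
          have h1 := norm_sub_le_of_mem_cube hx
          have h2 := norm_sub_norm_le x a
          rw [mem_ball_zero_iff]
          nlinarith
      _ = ENNReal.ofReal ((4 * n) ^ (n + γ)) * ENNReal.ofReal (r ^ (n + γ)) * I := by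
          rw [setLIntegral_ball_norm_rpow γ (by positivity), Real.mul_rpow (by positivity) hr.le,
            ENNReal.ofReal_mul (by positivity)]
      _ ≤ ENNReal.ofReal ((4 * n) ^ (n + γ)) * (ENNReal.ofReal (C₂ * (‖a‖ + r) ^ γ) *
            ENNReal.ofReal (r ^ n)) * I := by
          gcongr
          rw [← ENNReal.ofReal_mul (by positivity)]
          refine ENNReal.ofReal_le_ofReal ?_
          rw [add_comm, Real.rpow_add hr, Real.rpow_natCast]
          gcongr
          refine rpow_le_of_mem_Icc γ (by positivity) hρ ?_ (by linarith [norm_nonneg a])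
          rw [one_div, inv_mul_le_iff₀ (by positivity)]
          linarith
      _ = _ := by
          rw [ENNReal.coe_mul, ENNReal.coe_mul, ENNReal.ofNNReal_toNNReal C₂,
            ENNReal.coe_toNNReal hItop, ENNReal.ofReal_mul (by positivity),
            ENNReal.coe_rpow_of_ne_zero hn4, ENNReal.ofNNReal_toNNReal,
            ENNReal.ofReal_rpow_of_pos (by positivity)]
          ring

theorem ae_norm_pos {n : ℕ} (hn : n ≠ 0) : ∀ᵐ x : E n, 0 < ‖x‖ := by
  have : Nonempty (Fin n) := ⟨⟨0, Nat.pos_of_ne_zero hn⟩⟩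
  filter_upwards [Measure.ae_ne volume (0 : E n)] with x hx using norm_pos_iff.2 hx

theorem productWeight_norm_rpow {N n : ℕ} (p : ℝ) (P α : Fin N → ℝ) {x : E n} (hx : 0 < ‖x‖) :
    productWeight p P (fun k x => ‖x‖ ^ α k) x = ‖x‖ ^ (p * ∑ k, α k / P k) := by
  rw [productWeight, Finset.mul_sum, Real.rpow_sum_of_pos hx]
  refine Finset.prod_congr rfl fun k _ => ?_
  rw [← Real.rpow_mul hx.le]
  congr 1
  ring

theorem isWeight_norm_rpow {n : ℕ} (hn : n ≠ 0) (α : ℝ) : IsWeight fun x : E n => ‖x‖ ^ α where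
  measurable := by fun_prop
  nonneg x := by positivity
  ae_pos := (ae_norm_pos hn).mono fun x hx => by positivity

/-- Power weights in the class `A_{P/Q}`. -/
theorem memWeightClass_norm_rpow {N n : ℕ} (hn : n ≠ 0) {p : ℝ} (hp : 0 < p) {P Q α : Fin N → ℝ}
    (hQ : ∀ k, 0 < Q k) (hQP : ∀ k, Q k < P k) (hα : ∀ k, α k < n * (P k / Q k - 1))
    (hsum : -(n : ℝ) < p * ∑ k, α k / P k) :
    MemWeightClass p P Q fun k (x : E n) => ‖x‖ ^ α k where
  isWeight k := isWeight_norm_rpow hn (α k)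
  sup_lt_top := by
    have hP : ∀ k, 0 < P k := fun k => (hQ k).trans (hQP k)
    have ht : ∀ k, 0 < P k / Q k - 1 := fun k => by
      rw [sub_pos, lt_div_iff₀ (hQ k), one_mul]
      exact hQP k
    set γ : Fin N → ℝ := fun k => α k * (1 - Real.conjExponent (P k / Q k)) with hγdef
    have hγ' : ∀ k, γ k = -(α k / (P k / Q k - 1)) := fun k => by
      have := (ht k).ne'
      simp only [hγdef, Real.conjExponent]
      field_simp
      ring
    have hγ : ∀ k, -(n : ℝ) < γ k := fun k => by
      rw [hγ', neg_lt_neg_iff, div_lt_iff₀ (ht k)]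
      exact hα k
    -- This makes the powers of `‖a‖ + r` from the dual weights cancel the one from the product
    -- weight.
    have hexp : ∀ k, γ k * (1 / Q k - 1 / P k) = -(α k / P k) := fun k => by
      have h1 := (ht k).ne'
      have h2 := (hQ k).ne'
      have h3 := (hP k).ne'
      have h4 : P k - Q k ≠ 0 := (sub_pos.2 (hQP k)).ne'
      rw [hγ']
      field_simp
    have he0 : ∀ k, 0 ≤ 1 / Q k - 1 / P k := fun k =>
      sub_nonneg.2 (one_div_le_one_div_of_le (hQ k) (hQP k).le)
    obtain ⟨C₀, hC₀⟩ := exists_setLAverage_cube_norm_rpow_le hn hsum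
    choose C hC using fun k => exists_setLAverage_cube_norm_rpow_le hn (hγ k)
    refine lt_of_le_of_lt (b := ((C₀ : ℝ≥0∞) ^ (1 / p) *
      ∏ k, (C k : ℝ≥0∞) ^ (1 / Q k - 1 / P k))) ?_ ?_
    · refine iSup_le fun a => iSup_le fun r => iSup_le fun hr => ?_
      have hρ : 0 < ‖a‖ + r := by positivity
      -- The power laws used here and in `h1` can fail at the origin, a null set.
      have h0 : ⨍⁻ x in cube a r, ENNReal.ofReal (productWeight p P (fun k x => ‖x‖ ^ α k) x)
            ∂volume =
          ⨍⁻ x in cube a r, ENNReal.ofReal (‖x‖ ^ (p * ∑ k, α k / P k)) ∂volume :=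
        laverage_congr (ae_restrict_of_ae ((ae_norm_pos hn).mono fun x hx => by
          beta_reduce
          rw [productWeight_norm_rpow p P α hx]))
      have h1 : ∀ k, ⨍⁻ x in cube a r,
          ENNReal.ofReal (‖x‖ ^ α k) ^ (1 - Real.conjExponent (P k / Q k)) ∂volume =
          ⨍⁻ x in cube a r, ENNReal.ofReal (‖x‖ ^ γ k) ∂volume := fun k =>
        laverage_congr (ae_restrict_of_ae ((ae_norm_pos hn).mono fun x hx => by
          beta_reduce
          rw [ENNReal.ofReal_rpow_of_pos (by positivity), ← Real.rpow_mul hx.le]))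
      simp only [h0, h1]
      calc _ ≤ ((C₀ : ℝ≥0∞) * ENNReal.ofReal ((‖a‖ + r) ^ (p * ∑ k, α k / P k))) ^ (1 / p) *
            ∏ k, ((C k : ℝ≥0∞) * ENNReal.ofReal ((‖a‖ + r) ^ γ k)) ^ (1 / Q k - 1 / P k) := by
            refine mul_le_mul' (ENNReal.rpow_le_rpow (hC₀ a r hr) (by positivity))
              (Finset.prod_le_prod' fun k _ => ENNReal.rpow_le_rpow (hC k a r hr) (he0 k))
        _ = ((C₀ : ℝ≥0∞) ^ (1 / p) * ∏ k, (C k : ℝ≥0∞) ^ (1 / Q k - 1 / P k)) *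
            ENNReal.ofReal ((‖a‖ + r) ^ (∑ k, α k / P k) *
              ∏ k, (‖a‖ + r) ^ (-(α k / P k))) := by
            rw [ENNReal.mul_rpow_of_nonneg _ _ (by positivity), ENNReal.ofReal_mul (by positivity),
              ENNReal.ofReal_prod_of_nonneg (fun k _ => by positivity),
              ENNReal.ofReal_rpow_of_pos (by positivity), ← Real.rpow_mul hρ.le,
              mul_one_div, mul_div_cancel_left₀ _ hp.ne']
            rw [mul_mul_mul_comm, ← Finset.prod_mul_distrib]
            congr 1
            refine Finset.prod_congr rfl fun k _ => ?_
            rw [ENNReal.mul_rpow_of_nonneg _ _ (he0 k),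
              ENNReal.ofReal_rpow_of_pos (by positivity), ← Real.rpow_mul hρ.le, hexp]
        _ ≤ _ := by
            rw [← Real.rpow_sum_of_pos hρ, ← Real.rpow_add hρ, Finset.sum_neg_distrib,
              add_neg_cancel, Real.rpow_zero, ENNReal.ofReal_one, mul_one]
    · exact ENNReal.mul_lt_top (ENNReal.rpow_lt_top_of_nonneg (by positivity) ENNReal.coe_ne_top)
        (ENNReal.prod_lt_top fun k _ => ENNReal.rpow_lt_top_of_nonneg (he0 k) ENNReal.coe_ne_top)

/-! ### Failure of the estimate as the dilation parameter tends to infinity -/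

theorem memLp_top_prod_dilate {N n : ℕ} (χ : 𝓢(E n, ℂ)) (R : Fin N → ℝ) :
    MemLp (fun ξ : EN N n => ∏ k, χ (R k • ξ k)) ∞ volume := by
  have hcont : Continuous fun ξ : EN N n => ∏ k, χ (R k • ξ k) :=
    continuous_finsetProd _ fun k _ => χ.continuous.comp (by fun_prop)
  refine memLp_top_of_bound hcont.aestronglyMeasurable
    (∏ _k : Fin N, SchwartzMap.seminorm ℝ 0 0 χ) (Filter.Eventually.of_forall fun ξ => ?_)
  rw [norm_prod]
  exact Finset.prod_le_prod (fun _ _ => norm_nonneg _) fun _ _ => SchwartzMap.norm_le_seminorm ℝ χ _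

/-- Since `R k ≥ 1`, the points `x / R k` stay in the neighbourhood of the origin on which
continuity keeps the profile away from zero. -/
theorem exists_norm_prod_profile_ge {N n : ℕ} {χ φ : 𝓢(E n, ℂ)} (h0 : profile χ φ 0 ≠ 0) :
    ∃ c δ : ℝ, 0 < c ∧ 0 < δ ∧ ∀ R : Fin N → ℝ, (∀ k, 1 ≤ R k) → ∀ x, ‖x‖ < δ →
      c ≤ ‖∏ k, profile χ φ ((R k)⁻¹ • x)‖ := by
  have hpos := norm_pos_iff.2 h0
  obtain ⟨δ, hδ, hball⟩ := Metric.eventually_nhds_iff.1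
    ((continuous_profile χ φ).norm.continuousAt.eventually (lt_mem_nhds (half_lt_self hpos)))
  refine ⟨∏ _k : Fin N, ‖profile χ φ 0‖ / 2, δ, Finset.prod_pos fun _ _ => half_pos hpos, hδ,
    fun R hR x hx => ?_⟩
  rw [norm_prod]
  refine Finset.prod_le_prod (fun _ _ => by positivity) fun k _ => (hball ?_).le
  rw [dist_zero_right, norm_smul, norm_inv, Real.norm_of_nonneg (zero_le_one.trans (hR k))]
  exact (mul_le_of_le_one_left (norm_nonneg x) (inv_le_one_of_one_le₀ (hR k))).trans_lt hx

theorem prod_ite_rpow {N : ℕ} (i : Fin N) (R : ℝ) (e : Fin N → ℝ) :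
    ∏ k, (if k = i then R else 1) ^ e k = R ^ e i := by
  rw [Finset.prod_eq_single i (fun k _ hk => by simp [hk]) (by simp)]
  simp

/-- The multiplier estimate fails for power weights if the weight on one of the factors is too
singular at the origin. -/
theorem not_multiplierEstimate_norm_rpow {N n : ℕ} (hn : n ≠ 0) {p : ℝ} (hp : 0 < p)
    {P s α : Fin N → ℝ} (hP : ∀ k, 0 < P k) (hs : ∀ k, 0 ≤ s k) {i i' : Fin N} (hi : i' ≠ i)
    (hα : s i - n / 2 + (n + α i) / P i < 0) {Ψ : 𝓢(EN N n, ℂ)} (hΨ : IsDyadicPartition Ψ) :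
    ¬ MultiplierEstimate p P s (fun k (x : E n) => ‖x‖ ^ α k) Ψ := by
  rintro ⟨C, -, hest⟩
  set w : Fin N → E n → ℝ := fun k x => ‖x‖ ^ α k with hw
  obtain ⟨χ, φ, a, b, ha, hχ, hφ, hprof⟩ := exists_schwartz_pair hn
  obtain ⟨K, hK0, hK⟩ := exists_multiplierOp_prod_dilate N n
  obtain ⟨K₂, hK₂⟩ := exists_iSup_sobolevNorm_dyadicPiece_le hs χ ha hχ hΨ
  obtain ⟨c, δ, hc, hδ, hlow⟩ := exists_norm_prod_profile_ge (N := N) hprof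
  have hνm : Measurable (productWeight p P w) :=
    Finset.measurable_fun_prod _ fun k _ => by fun_prop
  have hν0 : ∀ᵐ x, 0 < productWeight p P w x := (ae_norm_pos hn).mono fun x hx => by
    rw [hw, productWeight_norm_rpow p P α hx]
    positivity
  obtain ⟨ε, hε, hle⟩ := weightedNorm_pos_of_le_norm hp hδ
    (mul_pos (norm_pos_iff.2 hK0) hc) hνm hν0
  have hA : ∀ k, weightedNorm (P k) (w k) φ < ∞ := fun k => weightedNorm_lt_top (hP k) φ hφ
  set B : ℝ≥0∞ := ((C : ℝ≥0∞) * K₂ + 1) * ∏ k, weightedNorm (P k) (w k) φ with hB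
  have hBtop : B ≠ ∞ := ENNReal.mul_ne_top (by finiteness)
    (ENNReal.prod_lt_top fun k _ => hA k).ne
  have key : ∀ R : ℝ, 1 ≤ R →
      ε ≤ B * ENNReal.ofReal (R ^ (s i - n / 2 + (n + α i) / P i)) := by
    intro R hR
    have hR0 : 0 < R := by linarith
    set Rv : Fin N → ℝ := fun k => if k = i then R else 1 with hRv
    have hRv1 : ∀ k, 1 ≤ Rv k := fun k => by
      simp only [hRv]
      split_ifs <;> linarith
    have hRv0 : ∀ k, 0 < Rv k := fun k => zero_lt_one.trans_le (hRv1 k)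
    set f : Fin N → 𝓢(E n, ℂ) := fun k => dilate (Rv k)⁻¹ (inv_ne_zero (hRv0 k).ne') φ with hf
    have hnorm : ∀ k, weightedNorm (P k) (w k) (f k) =
        ENNReal.ofReal (Rv k ^ ((n + α k) / P k)) * weightedNorm (P k) (w k) φ := fun k =>
      weightedNorm_comp_inv_smul (hP k) (hRv0 k) φ
    -- The extra `1` gives a strict inequality, so an admissible constant `M` can be taken from the
    -- infimum without showing that it is attained.
    have hop : opNorm p P w (productWeight p P w)
        (multiplierOp fun ξ : EN N n => ∏ k, χ (Rv k • ξ k)) <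
        ((C : ℝ≥0∞) * K₂ + 1) * ENNReal.ofReal (R ^ (s i - n / 2)) := by
      calc _ ≤ (C : ℝ≥0∞) * (K₂ * ENNReal.ofReal (R ^ (s i - n / 2))) := by
            refine (hest _ (memLp_top_prod_dilate χ Rv)).trans ?_
            rw [← prod_ite_rpow i R fun k => s k - n / 2]
            exact mul_le_mul_right (hK₂ Rv hRv1 ⟨i', by simp [hRv, hi]⟩) _
        _ < _ := by
            rw [← mul_assoc]
            refine ENNReal.mul_lt_mul_left (by positivity) ENNReal.ofReal_ne_top ?_
            exact ENNReal.lt_add_right (by finiteness) one_ne_zero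
    obtain ⟨M, hM, hMlt⟩ := sInf_lt_iff.1 hop
    calc ε ≤ weightedNorm p (productWeight p P w)
          (multiplierOp (fun ξ : EN N n => ∏ k, χ (Rv k • ξ k)) f) := by
          refine hle _ fun x hx => ?_
          rw [hK χ φ Rv hRv0 f (fun k => rfl), norm_mul]
          exact mul_le_mul_of_nonneg_left (hlow Rv hRv1 x hx) (norm_nonneg _)
      _ ≤ M * ∏ k, weightedNorm (P k) (w k) (f k) := by
          refine hM f fun k => ?_
          rw [hnorm]
          exact ENNReal.mul_lt_top ENNReal.ofReal_lt_top (hA k)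
      _ ≤ ((C : ℝ≥0∞) * K₂ + 1) * ENNReal.ofReal (R ^ (s i - n / 2)) *
          ∏ k, weightedNorm (P k) (w k) (f k) := by gcongr
      _ = _ := by
          simp only [hnorm]
          rw [Finset.prod_mul_distrib, ← ENNReal.ofReal_prod_of_nonneg
            (fun k _ => Real.rpow_nonneg (hRv0 k).le _), prod_ite_rpow i R, Real.rpow_add hR0,
            ENNReal.ofReal_mul (by positivity), hB]
          ring
  have hlim : Filter.Tendsto (fun R : ℝ => B * ENNReal.ofReal
      (R ^ (s i - n / 2 + (n + α i) / P i))) Filter.atTop (nhds (B * ENNReal.ofReal 0)) := by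
    refine ENNReal.Tendsto.const_mul (ENNReal.tendsto_ofReal ?_) (Or.inr hBtop)
    have h := tendsto_rpow_neg_atTop (neg_pos.2 hα)
    rwa [neg_neg] at h
  have h := ge_of_tendsto hlim (Filter.eventually_atTop.2 ⟨1, key⟩)
  rw [ENNReal.ofReal_zero, mul_zero] at h
  exact hε.not_ge h

/-! ### Choice of the exponents -/

/-- The exponents of the power weights `(|x|^{α₁}, |x|^{α₂}, 1, …, 1)`. -/
def powerExponent (N : ℕ) (α₁ α₂ : ℝ) (k : Fin N) : ℝ :=
  if k.val = 0 then α₁ else if k.val = 1 then α₂ else 0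

theorem powerWeights_eq (N n : ℕ) (α₁ α₂ : ℝ) :
    powerWeights N n α₁ α₂ = fun k x => ‖x‖ ^ powerExponent N α₁ α₂ k := by
  ext k x
  simp only [powerWeights, powerExponent]
  split_ifs <;> simp

end MultilinearMultiplier

end

theorem mainTheorem3 (N n : ℕ) (hN : 2 ≤ N) (p : ℝ) (P s : Fin N → ℝ)
    (hs : ∀ k, (n : ℝ) / 2 < s k ∧ s k ≤ n) (hP : ∀ k, (n : ℝ) / s k < P k)
    (hp : 1 / p = ∑ k, 1 / P k) :
    ∃ α₁ α₂ : ℝ,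
      (-(n : ℝ) / p < α₁ / P ⟨0, by omega⟩ + α₂ / P ⟨1, by omega⟩ ∧
        α₁ / P ⟨0, by omega⟩ < s ⟨0, by omega⟩ - n / P ⟨0, by omega⟩ ∧
        α₂ / P ⟨1, by omega⟩ < s ⟨1, by omega⟩ - n / P ⟨1, by omega⟩ ∧
        α₁ / P ⟨0, by omega⟩ < -(n : ℝ) / P ⟨0, by omega⟩ - s ⟨0, by omega⟩ + n / 2) ∧
      MultilinearMultiplier.MemWeightClass p P (fun k => (n : ℝ) / s k)
        (MultilinearMultiplier.powerWeights N n α₁ α₂) ∧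
      ∀ Ψ : 𝓢(MultilinearMultiplier.EN N n, ℂ), MultilinearMultiplier.IsDyadicPartition Ψ →
        ¬ MultilinearMultiplier.MultiplierEstimate p P s
          (MultilinearMultiplier.powerWeights N n α₁ α₂) Ψ := by
  have h01 : (⟨0, by omega⟩ : Fin N) ≠ ⟨1, by omega⟩ := by simp
  set i₀ : Fin N := ⟨0, by omega⟩ with hi₀
  set i₁ : Fin N := ⟨1, by omega⟩ with hi₁
  have hn : n ≠ 0 := by
    rintro rfl
    have := hs i₀
    simp only [Nat.cast_zero, zero_div] at this
    linarith
  have hn0 : (0 : ℝ) < n := by exact_mod_cast Nat.pos_of_ne_zero hn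
  have hs0 : ∀ k, 0 < s k := fun k => by linarith [(hs k).1]
  have hQ : ∀ k, 0 < (n : ℝ) / s k := fun k => div_pos hn0 (hs0 k)
  have hP0 : ∀ k, 0 < P k := fun k => (hQ k).trans (hP k)
  have hsum : 1 / P i₀ + 1 / P i₁ ≤ ∑ k, 1 / P k := by
    rw [← Finset.sum_pair (f := fun k => 1 / P k) h01]
    exact Finset.sum_le_sum_of_subset_of_nonneg (Finset.subset_univ _)
      fun k _ _ => (one_div_pos.2 (hP0 k)).le
  have hp0 : 0 < p := by
    rw [← one_div_pos, hp]
    linarith [one_div_pos.2 (hP0 i₀), one_div_pos.2 (hP0 i₁)]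
  have hsum' : -(n : ℝ) / p ≤ -(n : ℝ) / P i₀ - n / P i₁ := by
    rw [← hp] at hsum
    have := mul_le_mul_of_nonneg_left hsum hn0.le
    rw [mul_add, mul_one_div, mul_one_div, mul_one_div] at this
    rw [neg_div, neg_div]
    linarith
  -- The right side is positive because `s i₁ > n/2` and `s i₀ ≤ n`.
  obtain ⟨ε, hε, hεs⟩ : ∃ ε : ℝ, 0 < ε ∧ 2 * ε < s i₁ + n / 2 - s i₀ :=
    ⟨(s i₁ + n / 2 - s i₀) / 3, by linarith [(hs i₁).1, (hs i₀).2],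
      by linarith [(hs i₁).1, (hs i₀).2]⟩
  -- Here `β_k = α_k / p_k`, and each is its strictest upper bound minus `ε`. Their sum exceeds `-n
  -- / P i₀ - n / P i₁`, hence `-n / p`, by the choice of `ε`.
  set β₁ : ℝ := -(n : ℝ) / P i₀ - s i₀ + n / 2 - ε with hβ₁
  set β₂ : ℝ := s i₁ - n / P i₁ - ε with hβ₂
  have hα₁ : P i₀ * β₁ / P i₀ = β₁ := mul_div_cancel_left₀ _ (hP0 i₀).ne'
  have hα₂ : P i₁ * β₂ / P i₁ = β₂ := mul_div_cancel_left₀ _ (hP0 i₁).ne'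
  have hβ : -(n : ℝ) / p < β₁ + β₂ := by linarith
  have hβ₁s : β₁ < s i₀ - n / P i₀ := by
    have := (hs i₀).1
    rw [neg_div] at hβ₁
    linarith
  have hβ₂s : β₂ < s i₁ - n / P i₁ := by linarith
  refine ⟨P i₀ * β₁, P i₁ * β₂, ?_, ?_, fun Ψ hΨ => ?_⟩
  · rw [hα₁, hα₂]
    exact ⟨hβ, hβ₁s, hβ₂s, by linarith⟩
  · rw [MultilinearMultiplier.powerWeights_eq]
    refine MultilinearMultiplier.memWeightClass_norm_rpow hn hp0 hQ hP (fun k => ?_) ?_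
    -- Integrability of the dual weight thus reads `α_k / p_k < s_k - n / p_k`; for the constant
    -- weights this is `n / s_k < p_k`.
    · have h1 : (n : ℝ) * (P k / (n / s k) - 1) = P k * (s k - n / P k) := by
        have := (hP0 k).ne'
        field_simp
      rw [h1]
      unfold MultilinearMultiplier.powerExponent
      split_ifs with hk0 hk1
      · obtain rfl : k = i₀ := Fin.ext hk0
        exact mul_lt_mul_of_pos_left hβ₁s (hP0 _)
      · obtain rfl : k = i₁ := Fin.ext hk1
        exact mul_lt_mul_of_pos_left hβ₂s (hP0 _)
      · refine mul_pos (hP0 k) (sub_pos.2 ?_)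
        rw [div_lt_iff₀ (hP0 k), mul_comm, ← div_lt_iff₀ (hs0 k)]
        exact hP k
    · have h2 : ∑ k, MultilinearMultiplier.powerExponent N (P i₀ * β₁) (P i₁ * β₂) k / P k =
          β₁ + β₂ := by
        rw [← Finset.sum_subset (Finset.subset_univ {i₀, i₁}) fun k _ hk => ?_,
          Finset.sum_pair h01]
        · exact congrArg₂ (· + ·) hα₁ hα₂
        · simp only [Finset.mem_insert, Finset.mem_singleton, not_or, hi₀, hi₁, Fin.ext_iff] at hk
          simp [MultilinearMultiplier.powerExponent, hk.1, hk.2]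
      rw [h2, ← div_lt_iff₀' hp0]
      exact hβ
  · rw [MultilinearMultiplier.powerWeights_eq]
    refine MultilinearMultiplier.not_multiplierEstimate_norm_rpow hn hp0 hP0
      (fun k => (hs0 k).le) h01.symm ?_ hΨ
    -- With this `β₁` the total power of `R` is exactly `-ε`.
    have h3 : MultilinearMultiplier.powerExponent N (P i₀ * β₁) (P i₁ * β₂) i₀ = P i₀ * β₁ := rfl
    rw [h3, add_div, hα₁, hβ₁, neg_div]
    linarith
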